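/- **Setting.** Let $\mathcal X,\Omega$ be finite non-empty sets, $P^\ast$ a probability distribution on $\Omega$, and $k$ a positive-(semi)definite kernel on $\mathcal X\times\Omega$ with $k(z,z)\le 1$. Let $f$ be a sample path of the Gaussian process $\mathcal{GP}(0,k)$, let $\varepsilon_1,\varepsilon_2,\dots\sim N(0,\sigma^2)$ with $\sigma^2>0$, let $\xi_1,\xi_2,\dots$ be chi-squared distributed with two degrees of freedom, and let $f,\varepsilon_1,\varepsilon_2,\dots,\xi_1,\xi_2,\dots$ be mutually independent. Put $\beta_t=2\log|\mathcal X\times\Omega|+\xi_t$. **Robustness measures.** For $\varphi:\Omega\to\mathbb R$ and $w\sim P^\ast$ let $\rho(\varphi)$ be one of: the expectation $\mathbb E[\varphi(w)]$; the worst case $\min_\Omega\varphi$; the best case $\max_\Omega\varphi$; the value-at-risk $v_\alpha(\varphi)=\inf\{b:\alpha\le\mathbb P(\varphi(w)\le b)\}$; the conditional value-at-risk, in the form $\mathbb E[\varphi(w)\mid\varphi(w)\le v_\alpha(\varphi)]$ or in the form $\frac1\alpha\int_0^\alpha v_a(\varphi)\,da$ (they agree if $\mathbb P(\varphi(w)\le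 v_\alpha(\varphi))=\alpha$); or the mean absolute deviation $\mathbb E|\varphi(w)-\mathbb E\varphi(w)|$. Here $\alpha\in(0,1)$. Let $F(x)=\rho(f(x,\cdot))$ and $x^\ast\in\arg\max_{x} F(x)$. Put $q(a)=2a$, $C=8$ for the mean absolute deviation and $q(a)=a$, $C=4$ for the other measures. **Algorithm.** In iteration $t=1,2,\dots$ let $\mu_{t-1},\sigma^2_{t-1}$ be the Gaussian process posterior mean and variance of $f$ (prior $\mathcal{GP}(0,k)$, noise variance $\sigma^2$) given $(x_i,w_i,y_i)_{i<t}$, let $l_{t-1}=\mu_{t-1}-\beta_t^{1/2}\sigma_{t-1}$ and $u_{t-1}=\mu_{t-1}+\beta_t^{1/2}\sigma_{t-1}$, and choose, with bounds $\mathrm{lcb}_{t-1},\mathrm{ucb}_{t-1}:\mathcal X\to\mathbb R$, $$\hat x_t\in\arg\max_{x}\rho(\mu_{t-1}(x,\cdot)),\qquad \tilde x_t\in\arg\max_{x}\bigl(\mathrm{ucb}_{t-1}(x)-\max_{x'}\mathrm{lcb}_{t-1}(x')\bigr)_+,$$ $$x_t\in\arg\max_{x\in\{\tilde x_t,\hat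 x_t\}}\bigl(\mathrm{ucb}_{t-1}(x)-\mathrm{lcb}_{t-1}(x)\bigr),\qquad w_t\in\arg\max_{w}\sigma^2_{t-1}(x_t,w),$$ and then observe $y_t=f(x_t,w_t)+\varepsilon_t$. Ties are broken measurably, using only the past data $(x_i,w_i,y_i,\beta_i)_{i<t}$ for $\hat x_t$, and these and $\beta_t$ for $x_t,w_t$. **Bounds.** Assume that (a) or (b) holds. (a) For all $t,x$ and all $g:\Omega\to\mathbb R$ with $l_{t-1}(x,\cdot)\le g\le u_{t-1}(x,\cdot)$ one has $\mathrm{lcb}_{t-1}(x)\le\rho(g)\le\mathrm{ucb}_{t-1}(x)$, and $\mathrm{ucb}_{t-1}(x_t)-\mathrm{lcb}_{t-1}(x_t)\le q\bigl(2\beta_t^{1/2}\max_w\sigma_{t-1}(x_t,w)\bigr)$ for all $t$. (b) $\mathrm{lcb}_{t-1}(x)$ and $\mathrm{ucb}_{t-1}(x)$ are the following closed forms in $l=l_{t-1}(x,\cdot)$, $u=u_{t-1}(x,\cdot)$: for the expectation, worst case, best case and value-at-risk they are $\rho(l),\rho(u)$; for the conditional value-at-risk (either form) they are $\frac1\alpha\int_0^\alpha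 v_a(l)\,da$ and $\frac1\alpha\int_0^\alpha v_a(u)\,da$; for the mean absolute deviation they are $\mathbb E[\min\{|\check l|,|\check u|\}-\max\{\min\{-\check l,\check u\},0\}]$ and $\mathbb E[\max\{|\check l|,|\check u|\}]$ with $\check l=l-\mathbb E[u(w)]$, $\check u=u-\mathbb E[l(w)]$. If $\rho(\varphi)=\mathbb E[\varphi(w)\mid\varphi(w)\le v_\alpha(\varphi)]$, assume in addition that almost surely the two forms of the conditional value-at-risk agree for $\varphi=f(x,\cdot)$ and $\varphi=\mu_{t-1}(x,\cdot)$, for all $x,t$. **Conclusion.** For every $t\ge1$ the cumulative regret $R_t=\sum_{i=1}^t\{F(x^\ast)-F(\hat x_i)\}$ is integrable and $$\mathbb E[R_t]\le C\sqrt{t\,C_0\,\gamma_t},\qquad C_0=\frac{2(2\log|\mathcal X\times\Omega|+2)}{\log(1+\sigma^{-2})},\qquad \gamma_t=\frac12\max_{z_1,\dots,z_t\in\mathcal X\times\Omega}\log\det\bigl(I_t+\sigma^{-2}(k(z_i,z_j))_{i,j\le t}\bigr).$$ -/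

import Mathlib

open MeasureTheory ProbabilityTheory
open scoped NNReal Matrix

namespace RRGPUCB

noncomputable section

/-! ### Robustness measures -/

/-- The value-at-risk (`α`-quantile) `inf {b | α ≤ ℙ(φ ≤ b)}` of a function `φ` of the
environmental variable, whose law is `Pst`. -/
def valueAtRisk {Ω : Type*} [MeasurableSpace Ω] (Pst : Measure Ω) (α : ℝ) (φ : Ω → ℝ) : ℝ :=
  sInf {b : ℝ | α ≤ Pst.real {w | φ w ≤ b}}

/-- The conditional expectation `𝔼[φ | φ ≤ VaR_α(φ)]`. -/
def condTailMean {Ω : Type*} [MeasurableSpace Ω] (Pst : Measure Ω) (α : ℝ) (φ : Ω → ℝ) : ℝ :=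
  ∫ w, φ w ∂(ProbabilityTheory.cond Pst {w | φ w ≤ valueAtRisk Pst α φ})

/-- The average of the lower quantiles `(1/α) ∫₀^α VaR_a(φ) da`. -/
def quantileTailMean {Ω : Type*} [MeasurableSpace Ω] (Pst : Measure Ω) (α : ℝ) (φ : Ω → ℝ) : ℝ :=
  α⁻¹ * ∫ a in (0 : ℝ)..α, valueAtRisk Pst a φ

/-- The robustness measures under consideration. The conditional value-at-risk occurs in both of
its forms: as the conditional expectation `𝔼[φ | φ ≤ VaR_α(φ)]` (`condValueAtRisk`) and as the
average of the lower quantiles (`avgValueAtRisk`); they agree if `ℙ(φ ≤ VaR_α(φ)) = α`. -/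
inductive RobustnessMeasure where
  | expectation
  | worstCase
  | bestCase
  | valueAtRisk (α : ℝ)
  | condValueAtRisk (α : ℝ)
  | avgValueAtRisk (α : ℝ)
  | meanAbsDev

namespace RobustnessMeasure

/-- The level of a (conditional) value-at-risk lies in `(0, 1)`. -/
def LevelValid : RobustnessMeasure → Prop
  | valueAtRisk α => 0 < α ∧ α < 1
  | condValueAtRisk α => 0 < α ∧ α < 1
  | avgValueAtRisk α => 0 < α ∧ α < 1
  | _ => True

/-- The value `ρ(φ)`, for an environmental variable with law `Pst`. -/
def value {Ω : Type*} [MeasurableSpace Ω] (Pst : Measure Ω) :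
    RobustnessMeasure → (Ω → ℝ) → ℝ
  | expectation, φ => ∫ w, φ w ∂Pst
  | worstCase, φ => ⨅ w, φ w
  | bestCase, φ => ⨆ w, φ w
  | valueAtRisk α, φ => RRGPUCB.valueAtRisk Pst α φ
  | condValueAtRisk α, φ => condTailMean Pst α φ
  | avgValueAtRisk α, φ => quantileTailMean Pst α φ
  | meanAbsDev, φ => ∫ w, |φ w - ∫ w', φ w' ∂Pst| ∂Pst

/-- `STR(a, b) = max {min {-a, b}, 0}`. -/
def str (a b : ℝ) : ℝ := max (min (-a) b) 0

/-- The closed-form lower bound for `ρ` on the functions lying between `l` and `u`. -/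
def closedLcb {Ω : Type*} [MeasurableSpace Ω] (Pst : Measure Ω) :
    RobustnessMeasure → (Ω → ℝ) → (Ω → ℝ) → ℝ
  | expectation, l, _ => ∫ w, l w ∂Pst
  | worstCase, l, _ => ⨅ w, l w
  | bestCase, l, _ => ⨆ w, l w
  | valueAtRisk α, l, _ => RRGPUCB.valueAtRisk Pst α l
  | condValueAtRisk α, l, _ => quantileTailMean Pst α l
  | avgValueAtRisk α, l, _ => quantileTailMean Pst α l
  | meanAbsDev, l, u =>
      ∫ w, (min |l w - ∫ w', u w' ∂Pst| |u w - ∫ w', l w' ∂Pst|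
        - str (l w - ∫ w', u w' ∂Pst) (u w - ∫ w', l w' ∂Pst)) ∂Pst

/-- The closed-form upper bound for `ρ` on the functions lying between `l` and `u`. -/
def closedUcb {Ω : Type*} [MeasurableSpace Ω] (Pst : Measure Ω) :
    RobustnessMeasure → (Ω → ℝ) → (Ω → ℝ) → ℝ
  | expectation, _, u => ∫ w, u w ∂Pst
  | worstCase, _, u => ⨅ w, u w
  | bestCase, _, u => ⨆ w, u w
  | valueAtRisk α, _, u => RRGPUCB.valueAtRisk Pst α u
  | condValueAtRisk α, _, u => quantileTailMean Pst α u
  | avgValueAtRisk α, _, u => quantileTailMean Pst α u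
  | meanAbsDev, l, u =>
      ∫ w, max |l w - ∫ w', u w' ∂Pst| |u w - ∫ w', l w' ∂Pst| ∂Pst

/-- The function `q` bounding the width of the credible intervals. -/
def q : RobustnessMeasure → ℝ → ℝ
  | meanAbsDev, a => 2 * a
  | _, a => a

/-- The constant `C` of the regret bound. -/
def regretConst : RobustnessMeasure → ℝ
  | meanAbsDev => 8
  | _ => 4

end RobustnessMeasure

/-! ### Gaussian process regression -/

/-- The kernel matrix of the points `z`. -/
def gram {Z : Type*} (k : Z → Z → ℝ) {n : ℕ} (z : Fin n → Z) : Matrix (Fin n) (Fin n) ℝ :=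
  Matrix.of fun i j => k (z i) (z j)

/-- Posterior mean at `a`, given observations `y` at `z` with noise variance `v`. -/
def postMean {Z : Type*} (k : Z → Z → ℝ) (v : ℝ) {n : ℕ} (z : Fin n → Z) (y : Fin n → ℝ)
    (a : Z) : ℝ :=
  (fun j => k a (z j)) ⬝ᵥ ((gram k z + v • (1 : Matrix (Fin n) (Fin n) ℝ))⁻¹ *ᵥ y)

/-- Posterior variance at `a`, given observations at `z` with noise variance `v`. -/
def postVar {Z : Type*} (k : Z → Z → ℝ) (v : ℝ) {n : ℕ} (z : Fin n → Z) (a : Z) : ℝ :=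
  k a a - (fun j => k a (z j)) ⬝ᵥ
    ((gram k z + v • (1 : Matrix (Fin n) (Fin n) ℝ))⁻¹ *ᵥ fun j => k a (z j))

/-- Maximum information gain `γ_t`. -/
def maxInfoGain {Z : Type*} (k : Z → Z → ℝ) (v : ℝ) (t : ℕ) : ℝ :=
  1 / 2 * ⨆ z : Fin t → Z,
    Real.log ((1 : Matrix (Fin t) (Fin t) ℝ) + v⁻¹ • gram k z).det

/-- The chi-squared distribution with `d` degrees of freedom, as the Gamma distribution with
shape `d / 2` and rate `1 / 2`. -/
def chiSquared (d : ℕ) : Measure ℝ := gammaMeasure ((d : ℝ) / 2) (1 / 2)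

/-! ### The probabilistic model -/

/-- The σ-algebras generated by `f`, by each `ε n` and by each `ξ n`. -/
abbrev sourceSigma {Z S : Type*} (f : S → Z → ℝ) (ε ξ : ℕ → S → ℝ) :
    Option (ℕ ⊕ ℕ) → MeasurableSpace S
  | none => MeasurableSpace.comap f inferInstance
  | some (Sum.inl n) => MeasurableSpace.comap (ε n) inferInstance
  | some (Sum.inr n) => MeasurableSpace.comap (ξ n) inferInstance

/-- `f` is a sample path of the centered Gaussian process with kernel `k`, the noise terms
`ε 0, ε 1, …` have law `N(0, v)`, the variables `ξ 0, ξ 1, …` are chi-squared distributed with two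
degrees of freedom, and `f, ε 0, ε 1, …, ξ 0, ξ 1, …` are mutually independent. -/
structure IsModel {Z S : Type*} [Fintype Z] [MeasurableSpace S] (P : Measure S)
    (k : Z → Z → ℝ) (v : ℝ≥0) (f : S → Z → ℝ) (ε ξ : ℕ → S → ℝ) : Prop where
  kernel_posSemidef : (Matrix.of k).PosSemidef
  kernel_le_one : ∀ z, k z z ≤ 1
  measurable_f : Measurable f
  measurable_noise : ∀ n, Measurable (ε n)
  measurable_xi : ∀ n, Measurable (ξ n)
  gaussian : IsGaussianProcess (fun z s => f s z) P
  mean_zero : ∀ z, ∫ s, f s z ∂P = 0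
  covariance_eq : ∀ z z', covariance (fun s => f s z) (fun s => f s z') P = k z z'
  noise_law : ∀ n, HasLaw (ε n) (gaussianReal 0 v) P
  xi_law : ∀ n, HasLaw (ξ n) (chiSquared 2) P
  indep : iIndep (sourceSigma f ε ξ) P

/-! ### The algorithm

Iterations are numbered from `0`: index `n` stands for the iteration `t = n + 1`, in which the data
of the `n` iterations `0, …, n - 1` are available. -/

/-- `β_t = 2 log |𝒳 × Ω| + ξ_t`. -/
def beta (X Ω : Type*) [Fintype X] [Fintype Ω] {S : Type*} (ξ : ℕ → S → ℝ) (n : ℕ) (s : S) : ℝ :=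
  2 * Real.log (Fintype.card (X × Ω)) + ξ n s

/-- The noisy observation `y = f(x, w) + ε`. -/
def obs {X Ω S : Type*} (f : S → X × Ω → ℝ) (ε : ℕ → S → ℝ) (x : ℕ → S → X) (w : ℕ → S → Ω)
    (n : ℕ) (s : S) : ℝ :=
  f s (x n s, w n s) + ε n s

/-- Posterior mean at the start of iteration `n`. -/
def mu {X Ω S : Type*} (k : X × Ω → X × Ω → ℝ) (v : ℝ≥0) (f : S → X × Ω → ℝ) (ε : ℕ → S → ℝ)
    (x : ℕ → S → X) (w : ℕ → S → Ω) (n : ℕ) (s : S) (z : X × Ω) : ℝ :=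
  postMean k v (fun i : Fin n => (x i s, w i s)) (fun i : Fin n => obs f ε x w i s) z

/-- Posterior variance at the start of iteration `n`. -/
def var {X Ω S : Type*} (k : X × Ω → X × Ω → ℝ) (v : ℝ≥0)
    (x : ℕ → S → X) (w : ℕ → S → Ω) (n : ℕ) (s : S) (z : X × Ω) : ℝ :=
  postVar k v (fun i : Fin n => (x i s, w i s)) z

/-- Lower end of the credible interval for `f z` in iteration `n`. -/
def lower {X Ω S : Type*} [Fintype X] [Fintype Ω] (k : X × Ω → X × Ω → ℝ) (v : ℝ≥0)
    (f : S → X × Ω → ℝ) (ε ξ : ℕ → S → ℝ) (x : ℕ → S → X) (w : ℕ → S → Ω)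
    (n : ℕ) (s : S) (z : X × Ω) : ℝ :=
  mu k v f ε x w n s z - √(beta X Ω ξ n s) * √(var k v x w n s z)

/-- Upper end of the credible interval for `f z` in iteration `n`. -/
def upper {X Ω S : Type*} [Fintype X] [Fintype Ω] (k : X × Ω → X × Ω → ℝ) (v : ℝ≥0)
    (f : S → X × Ω → ℝ) (ε ξ : ℕ → S → ℝ) (x : ℕ → S → X) (w : ℕ → S → Ω)
    (n : ℕ) (s : S) (z : X × Ω) : ℝ :=
  mu k v f ε x w n s z + √(beta X Ω ξ n s) * √(var k v x w n s z)

/-- The σ-algebra generated by the data `(x, w, y, β)` of the iterations `0, …, n - 1`. -/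
abbrev history {X Ω S : Type*} [Fintype X] [Fintype Ω] [MeasurableSpace X] [MeasurableSpace Ω]
    (f : S → X × Ω → ℝ) (ε ξ : ℕ → S → ℝ) (x : ℕ → S → X) (w : ℕ → S → Ω) (n : ℕ) :
    MeasurableSpace S :=
  ⨆ i : Fin n, MeasurableSpace.comap
    (fun s => (x i s, w i s, obs f ε x w i s, beta X Ω ξ i s)) inferInstance

/-- `x, w` are the evaluation points and `xhat` the estimated solutions of a run of the algorithm
with robustness measure `ρ` and bounds `lcb, ucb` (with optimistic solutions `xtil`). Ties in the
maximizations may be broken in any way that uses only the data available: the past data for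
`xhat n`, and the past data and `β` for `x n, w n`. -/
structure IsRun {X Ω S : Type*} [Fintype X] [Fintype Ω] [MeasurableSpace X] [MeasurableSpace Ω]
    (Pst : Measure Ω) (ρ : RobustnessMeasure) (k : X × Ω → X × Ω → ℝ) (v : ℝ≥0)
    (f : S → X × Ω → ℝ) (ε ξ : ℕ → S → ℝ) (lcb ucb : ℕ → S → X → ℝ)
    (xhat xtil x : ℕ → S → X) (w : ℕ → S → Ω) : Prop where
  xhat_measurable : ∀ n, Measurable[history f ε ξ x w n] (xhat n)
  x_measurable : ∀ n, Measurable[history f ε ξ x w n ⊔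
    MeasurableSpace.comap (beta X Ω ξ n) inferInstance] (x n)
  w_measurable : ∀ n, Measurable[history f ε ξ x w n ⊔
    MeasurableSpace.comap (beta X Ω ξ n) inferInstance] (w n)
  xhat_max : ∀ n s a, ρ.value Pst (fun b => mu k v f ε x w n s (a, b)) ≤
    ρ.value Pst (fun b => mu k v f ε x w n s (xhat n s, b))
  xtil_max : ∀ n s a, max (ucb n s a - ⨆ a', lcb n s a') 0 ≤
    max (ucb n s (xtil n s) - ⨆ a', lcb n s a') 0
  x_mem : ∀ n s, x n s = xtil n s ∨ x n s = xhat n s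
  x_max_xtil : ∀ n s, ucb n s (xtil n s) - lcb n s (xtil n s) ≤ ucb n s (x n s) - lcb n s (x n s)
  x_max_xhat : ∀ n s, ucb n s (xhat n s) - lcb n s (xhat n s) ≤ ucb n s (x n s) - lcb n s (x n s)
  w_max : ∀ n s b, var k v x w n s (x n s, b) ≤ var k v x w n s (x n s, w n s)

/-- `lcb ≤ ρ(g) ≤ ucb` for every function `g` of the environmental variable whose values lie in
the credible intervals of `f(a, ·)`. -/
def IsEnclosure {X Ω S : Type*} [Fintype X] [Fintype Ω] [MeasurableSpace Ω]
    (Pst : Measure Ω) (ρ : RobustnessMeasure) (k : X × Ω → X × Ω → ℝ) (v : ℝ≥0)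
    (f : S → X × Ω → ℝ) (ε ξ : ℕ → S → ℝ) (lcb ucb : ℕ → S → X → ℝ)
    (x : ℕ → S → X) (w : ℕ → S → Ω) : Prop :=
  ∀ n s a, ∀ g : Ω → ℝ,
    (∀ b, lower k v f ε ξ x w n s (a, b) ≤ g b ∧ g b ≤ upper k v f ε ξ x w n s (a, b)) →
      lcb n s a ≤ ρ.value Pst g ∧ ρ.value Pst g ≤ ucb n s a

/-- `ucb - lcb ≤ q(2 β^{1/2} max_w σ(x_t, w))` at the selected points. -/
def HasWidthBound {X Ω S : Type*} [Fintype X] [Fintype Ω]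
    (ρ : RobustnessMeasure) (k : X × Ω → X × Ω → ℝ) (v : ℝ≥0)
    (ξ : ℕ → S → ℝ) (lcb ucb : ℕ → S → X → ℝ) (x : ℕ → S → X) (w : ℕ → S → Ω) : Prop :=
  ∀ n s, ucb n s (x n s) - lcb n s (x n s) ≤
    ρ.q (2 * √(beta X Ω ξ n s) * ⨆ b, √(var k v x w n s (x n s, b)))

/-- `lcb, ucb` are the closed-form bounds of `ρ`, evaluated at the credible intervals of `f`. -/
def IsClosedForm {X Ω S : Type*} [Fintype X] [Fintype Ω] [MeasurableSpace Ω]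
    (Pst : Measure Ω) (ρ : RobustnessMeasure) (k : X × Ω → X × Ω → ℝ) (v : ℝ≥0)
    (f : S → X × Ω → ℝ) (ε ξ : ℕ → S → ℝ) (lcb ucb : ℕ → S → X → ℝ)
    (x : ℕ → S → X) (w : ℕ → S → Ω) : Prop :=
  ∀ n s a,
    lcb n s a = ρ.closedLcb Pst (fun b => lower k v f ε ξ x w n s (a, b))
      (fun b => upper k v f ε ξ x w n s (a, b)) ∧
    ucb n s a = ρ.closedUcb Pst (fun b => lower k v f ε ξ x w n s (a, b))
      (fun b => upper k v f ε ξ x w n s (a, b))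

/-- A condition on the conditional value-at-risk in its form `𝔼[φ | φ ≤ VaR_α(φ)]` only: almost
surely it agrees with the average of the lower quantiles for `φ = f(a, ·)` and for the posterior
means `φ = μ(a, ·)`. -/
def TailFormsAgree {X Ω S : Type*} [MeasurableSpace Ω] [MeasurableSpace S]
    (P : Measure S) (Pst : Measure Ω) (ρ : RobustnessMeasure) (k : X × Ω → X × Ω → ℝ) (v : ℝ≥0)
    (f : S → X × Ω → ℝ) (ε : ℕ → S → ℝ) (x : ℕ → S → X) (w : ℕ → S → Ω) : Prop :=
  ∀ α, ρ = RobustnessMeasure.condValueAtRisk α → ∀ᵐ s ∂P, ∀ a,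
    condTailMean Pst α (fun b => f s (a, b)) = quantileTailMean Pst α (fun b => f s (a, b)) ∧
    ∀ n, condTailMean Pst α (fun b => mu k v f ε x w n s (a, b)) =
      quantileTailMean Pst α (fun b => mu k v f ε x w n s (a, b))

/-- Cumulative regret `R_t = ∑ (F(x*) - F(x̂))` over the first `t` iterations, where
`F(a) = ρ(f(a, ·))`. -/
def cumRegret {X Ω S : Type*} [MeasurableSpace Ω] (Pst : Measure Ω) (ρ : RobustnessMeasure)
    (f : S → X × Ω → ℝ) (xstar : S → X) (xhat : ℕ → S → X) (t : ℕ) (s : S) : ℝ :=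
  ∑ n ∈ Finset.range t, (ρ.value Pst (fun b => f s (xstar s, b)) -
    ρ.value Pst (fun b => f s (xhat n s, b)))

end

end RRGPUCB

/-! Fix an iteration and condition on its past data. Then each `f a` is Gaussian with the posterior
mean and variance, so by a union bound over the `N = |𝒳 × Ω|` points the largest squared deviation
from the posterior mean, in units of the posterior variance, exceeds `t` with probability at most
`min(1, N exp(-t/2))`. This is exactly the tail of `β = 2 log N + ξ`, because a chi-squared variable
with two degrees of freedom has tail `exp(-t/2)`. Thus, given the past, the largest deviation is
stochastically dominated by `β`, which is independent of the past (`deviation_dominated`).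

The true `f` need not lie in the credible intervals. But `x̂` depends on the past only, so
domination is enough: any bound on the regret of `x̂` that holds for every function in the intervals
of half-width `√β σ` bounds the true regret in expectation (`lintegral_le_lintegral_of_dominated`,
`lintegral_gap_le`).

For functions in the intervals the argument is deterministic. Since the posterior mean lies in the
intervals and `x̂` maximizes its `ρ`-value, `ucb(x̂)` is at least `max lcb`; the rules for `x̃` and
`x_t` then bound the regret by twice the width at `x_t` (`gap_le_two_mul_width`), hence by `C √β
σ(x_t, w_t)`. Summation uses Cauchy–Schwarz, Jensen for the square root, `𝔼[β] = 2 log N + 2`, and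
the bound on the sum of posterior variances by the information gain (`sum_postVar_le`).

The evaluation points are adaptive, whereas Gaussian conditioning is done at fixed points. As there
are finitely many sequences of points, the probability space is split along them; each piece is an
event in the observations at fixed points and the `ξ`s (`measurableSet_path`, `deviation_tail_le`).
-/

namespace RRGPUCB

/-! ### Monetary functionals -/

/-- A functional which is monotone and does not increase by more than `c` when a constant `c` is
added to its argument. -/
structure IsMonetary {Ω : Type*} (r : (Ω → ℝ) → ℝ) : Prop where
  mono : ∀ φ ψ : Ω → ℝ, (∀ w, φ w ≤ ψ w) → r φ ≤ r ψ
  add_const_le : ∀ (φ : Ω → ℝ) (c : ℝ), r (fun w => φ w + c) ≤ r φ + c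

theorem IsMonetary.le_add {Ω : Type*} {r : (Ω → ℝ) → ℝ} (hr : IsMonetary r) {φ ψ : Ω → ℝ} {c : ℝ}
    (h : ∀ w, φ w ≤ ψ w + c) : r φ ≤ r ψ + c :=
  (hr.mono _ _ h).trans (hr.add_const_le ψ c)

/-- The two axioms make `r` 1-Lipschitz for the sup distance. -/
theorem IsMonetary.measurable {Ω : Type*} [Fintype Ω] {r : (Ω → ℝ) → ℝ} (hr : IsMonetary r) :
    Measurable r := by
  have : LipschitzWith 1 r := by
    refine LipschitzWith.of_le_add fun φ ψ => hr.le_add fun w => ?_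
    have := (abs_le.1 ((Real.dist_eq (φ w) (ψ w)).symm.le.trans (dist_le_pi_dist φ ψ w))).2
    linarith
  exact this.continuous.measurable

theorem exists_abs_le {Ω : Type*} [Finite Ω] (φ : Ω → ℝ) : ∃ M, ∀ w, |φ w| ≤ M := by
  obtain ⟨M, hM⟩ := (Set.finite_range fun w => |φ w|).bddAbove
  exact ⟨M, fun w => hM ⟨w, rfl⟩⟩

theorem isMonetary_iInf {Ω : Type*} [Finite Ω] [Nonempty Ω] :
    IsMonetary fun φ : Ω → ℝ => ⨅ w, φ w where
  mono φ ψ h := ciInf_mono (Set.finite_range φ).bddBelow h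
  add_const_le φ c := by
    rw [← sub_le_iff_le_add]
    refine le_ciInf fun w => ?_
    rw [sub_le_iff_le_add]
    exact ciInf_le (Set.finite_range fun w => φ w + c).bddBelow w

theorem isMonetary_iSup {Ω : Type*} [Finite Ω] [Nonempty Ω] :
    IsMonetary fun φ : Ω → ℝ => ⨆ w, φ w where
  mono φ ψ h := ciSup_mono (Set.finite_range ψ).bddAbove h
  add_const_le φ c := ciSup_le fun w => by
    have := le_ciSup (Set.finite_range φ).bddAbove w
    linarith

/-! ### Quantiles of a function on a finite probability space. -/

theorem le_of_level_le {Ω : Type*} [MeasurableSpace Ω] (Pst : Measure Ω)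
    {a b M : ℝ} {φ : Ω → ℝ} (ha : 0 < a) (hM : ∀ w, M ≤ φ w)
    (h : a ≤ Pst.real {w | φ w ≤ b}) : M ≤ b := by
  by_contra! hb
  have : {w | φ w ≤ b} = ∅ := by
    ext w
    simpa using hb.trans_le (hM w)
  rw [this] at h
  simp at h
  linarith

theorem level_le_of_le {Ω : Type*} [MeasurableSpace Ω] (Pst : Measure Ω)
    [IsProbabilityMeasure Pst] {a M : ℝ} {φ : Ω → ℝ} (ha : a ≤ 1) (hM : ∀ w, φ w ≤ M) :
    a ≤ Pst.real {w | φ w ≤ M} := by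
  have : {w | φ w ≤ M} = Set.univ := by
    ext w
    simpa using hM w
  rw [this]
  simpa using ha

theorem bddBelow_levels {Ω : Type*} [Finite Ω] [MeasurableSpace Ω] (Pst : Measure Ω)
    {a : ℝ} (ha : 0 < a) (φ : Ω → ℝ) :
    BddBelow {b : ℝ | a ≤ Pst.real {w | φ w ≤ b}} := by
  obtain ⟨M, hM⟩ := exists_abs_le φ
  exact ⟨-M, fun b hb => le_of_level_le Pst ha (fun w => (abs_le.1 (hM w)).1) hb⟩

theorem nonempty_levels {Ω : Type*} [Finite Ω] [MeasurableSpace Ω] (Pst : Measure Ω)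
    [IsProbabilityMeasure Pst] {a : ℝ} (ha : a ≤ 1) (φ : Ω → ℝ) :
    {b : ℝ | a ≤ Pst.real {w | φ w ≤ b}}.Nonempty := by
  obtain ⟨M, hM⟩ := exists_abs_le φ
  exact ⟨M, level_le_of_le Pst ha fun w => (abs_le.1 (hM w)).2⟩

theorem isMonetary_valueAtRisk {Ω : Type*} [Finite Ω] [MeasurableSpace Ω] (Pst : Measure Ω)
    [IsProbabilityMeasure Pst] {a : ℝ} (ha : 0 < a) (ha' : a ≤ 1) :
    IsMonetary (valueAtRisk Pst a) where
  mono φ ψ h := by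
    refine csInf_le_csInf (bddBelow_levels Pst ha φ) (nonempty_levels Pst ha' ψ) fun b hb => ?_
    exact le_trans hb (measureReal_mono fun w hw => (h w).trans hw)
  add_const_le φ c := by
    rw [← sub_le_iff_le_add]
    refine le_csInf (nonempty_levels Pst ha' φ) fun b hb => ?_
    rw [sub_le_iff_le_add]
    refine csInf_le (bddBelow_levels Pst ha _) ?_
    simpa using hb

/-- The quantile is monotone in the level and bounded by any bound of `|φ|`. Level `0` is left out:
there the defining set is all of `ℝ` and its infimum is a default value. -/
theorem intervalIntegrable_valueAtRisk {Ω : Type*} [Finite Ω] [MeasurableSpace Ω] (Pst : Measure Ω)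
    [IsProbabilityMeasure Pst] {α : ℝ} (hα : 0 ≤ α) (hα' : α ≤ 1) (φ : Ω → ℝ) :
    IntervalIntegrable (fun a => valueAtRisk Pst a φ) volume 0 α := by
  rw [intervalIntegrable_iff_integrableOn_Ioc_of_le hα]
  have hmono : MonotoneOn (fun a => valueAtRisk Pst a φ) (Set.Ioc 0 α) := fun a ha b hb hab =>
    csInf_le_csInf (bddBelow_levels Pst ha.1 φ) (nonempty_levels Pst (hb.2.trans hα') φ)
      fun c hc => hab.trans hc
  obtain ⟨M, hM⟩ := exists_abs_le φ
  refine ⟨(aemeasurable_restrict_of_monotoneOn measurableSet_Ioc hmono).aestronglyMeasurable,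
    HasFiniteIntegral.of_bounded (C := M) ?_⟩
  refine (ae_restrict_iff' measurableSet_Ioc).2 (ae_of_all _ fun a ha => ?_)
  rw [Real.norm_eq_abs, abs_le]
  refine ⟨le_csInf (nonempty_levels Pst (ha.2.trans hα') φ) fun b hb =>
    le_of_level_le Pst ha.1 (fun w => (abs_le.1 (hM w)).1) hb,
    csInf_le (bddBelow_levels Pst ha.1 φ)
      (level_le_of_le Pst (ha.2.trans hα') fun w => (abs_le.1 (hM w)).2)⟩

theorem isMonetary_quantileTailMean {Ω : Type*} [Finite Ω] [MeasurableSpace Ω] (Pst : Measure Ω)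
    [IsProbabilityMeasure Pst] {α : ℝ} (hα : 0 < α) (hα' : α ≤ 1) :
    IsMonetary (quantileTailMean Pst α) where
  mono φ ψ h := by
    refine mul_le_mul_of_nonneg_left ?_ (inv_nonneg.2 hα.le)
    refine intervalIntegral.integral_mono_on_of_le_Ioo hα.le
      (intervalIntegrable_valueAtRisk Pst hα.le hα' φ)
      (intervalIntegrable_valueAtRisk Pst hα.le hα' ψ) fun a ha => ?_
    exact (isMonetary_valueAtRisk Pst ha.1 (ha.2.le.trans hα')).mono _ _ h
  add_const_le φ c := by
    have hi := intervalIntegrable_valueAtRisk Pst hα.le hα' φ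
    have : ∫ a in (0 : ℝ)..α, valueAtRisk Pst a (fun w => φ w + c) ≤
        ∫ a in (0 : ℝ)..α, (valueAtRisk Pst a φ + c) := by
      refine intervalIntegral.integral_mono_on_of_le_Ioo hα.le
        (intervalIntegrable_valueAtRisk Pst hα.le hα' _)
        (hi.add intervalIntegrable_const) fun a ha => ?_
      exact (isMonetary_valueAtRisk Pst ha.1 (ha.2.le.trans hα')).add_const_le _ _
    rw [intervalIntegral.integral_add hi intervalIntegrable_const,
      intervalIntegral.integral_const] at this
    calc quantileTailMean Pst α (fun w => φ w + c)
        ≤ α⁻¹ * ((∫ a in (0 : ℝ)..α, valueAtRisk Pst a φ) + (α - 0) • c) :=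
          mul_le_mul_of_nonneg_left this (inv_nonneg.2 hα.le)
      _ = quantileTailMean Pst α φ + c := by
          rw [quantileTailMean, smul_eq_mul]
          field_simp
          ring

section Robustness

variable {Ω : Type*} [Fintype Ω] [MeasurableSpace Ω] [MeasurableSingletonClass Ω]
  (Pst : Measure Ω) [IsProbabilityMeasure Pst]

theorem isMonetary_expectation : IsMonetary fun φ : Ω → ℝ => ∫ w, φ w ∂Pst where
  mono φ ψ h := integral_mono .of_finite .of_finite h
  add_const_le φ c := by
    rw [integral_add .of_finite .of_finite]
    simp

/-- Serves the measurability of the conditional tail mean. In the presence of atoms this functional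
need not be monotone, so the Lipschitz argument is not available. -/
theorem condTailMean_eq_sum (α : ℝ) (φ : Ω → ℝ) :
    condTailMean Pst α φ =
      (∑ w, if φ w ≤ valueAtRisk Pst α φ then Pst.real {w} else 0)⁻¹ *
        ∑ w, if φ w ≤ valueAtRisk Pst α φ then Pst.real {w} * φ w else 0 := by
  set c := valueAtRisk Pst α φ
  have hms : MeasurableSet {w | φ w ≤ c} := Set.Finite.measurableSet (Set.toFinite _)
  have h1 : Pst.real {w | φ w ≤ c} = ∑ w, if φ w ≤ c then Pst.real {w} else 0 := by
    rw [← integral_indicator_one hms, integral_fintype .of_finite]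
    refine Finset.sum_congr rfl fun w _ => ?_
    by_cases h : φ w ≤ c <;> simp [Set.indicator, h]
  have h2 : ∫ w in {w | φ w ≤ c}, φ w ∂Pst =
      ∑ w, if φ w ≤ c then Pst.real {w} * φ w else 0 := by
    rw [← integral_indicator hms, integral_fintype .of_finite]
    refine Finset.sum_congr rfl fun w _ => ?_
    by_cases h : φ w ≤ c <;> simp [Set.indicator, h]
  rw [condTailMean, ProbabilityTheory.cond, integral_smul_measure, h2, ← h1, smul_eq_mul,
    ENNReal.toReal_inv, measureReal_def]

theorem measurable_condTailMean {α : ℝ} (hα : 0 < α) (hα' : α ≤ 1) :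
    Measurable (condTailMean Pst α : (Ω → ℝ) → ℝ) := by
  have hv := (isMonetary_valueAtRisk Pst hα hα').measurable
  have hs : ∀ w : Ω, MeasurableSet {φ : Ω → ℝ | φ w ≤ valueAtRisk Pst α φ} := fun w =>
    measurableSet_le (measurable_pi_apply w) hv
  have : (condTailMean Pst α : (Ω → ℝ) → ℝ) = fun φ =>
      (∑ w, if φ w ≤ valueAtRisk Pst α φ then Pst.real {w} else 0)⁻¹ *
        ∑ w, if φ w ≤ valueAtRisk Pst α φ then Pst.real {w} * φ w else 0 :=
    funext (condTailMean_eq_sum Pst α)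
  rw [this]
  refine Measurable.mul (Measurable.inv ?_) ?_
  · exact Finset.measurable_sum _ fun w _ => Measurable.ite (hs w) measurable_const measurable_const
  · exact Finset.measurable_sum _ fun w _ => Measurable.ite (hs w)
      ((measurable_pi_apply w).const_mul _) measurable_const

namespace RobustnessMeasure

theorem measurable_value {ρ : RobustnessMeasure} (hρ : ρ.LevelValid) :
    Measurable (ρ.value Pst : (Ω → ℝ) → ℝ) := by
  have : Nonempty Ω := nonempty_of_isProbabilityMeasure Pst
  cases ρ with
  | expectation => exact (isMonetary_expectation Pst).measurable
  | worstCase => exact isMonetary_iInf.measurable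
  | bestCase => exact isMonetary_iSup.measurable
  | valueAtRisk α => exact (isMonetary_valueAtRisk Pst hρ.1 hρ.2.le).measurable
  | condValueAtRisk α => exact measurable_condTailMean Pst hρ.1 hρ.2.le
  | avgValueAtRisk α => exact (isMonetary_quantileTailMean Pst hρ.1 hρ.2.le).measurable
  | meanAbsDev =>
    have h : (meanAbsDev.value Pst : (Ω → ℝ) → ℝ) = fun φ =>
        ∑ w, Pst.real {w} • |φ w - ∑ w', Pst.real {w'} • φ w'| := by
      funext φ
      simp only [value, integral_fintype (Integrable.of_finite (μ := Pst))]
    rw [h]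
    fun_prop

end RobustnessMeasure

/-! ### The closed-form bounds -/

/-- The absolute value is largest at an endpoint. It is smallest at an endpoint too unless the
interval contains `0`; in that case `str a b` equals the smaller of `|a|` and `|b|` and lowers the
bound to `0`. -/
theorem abs_bounds_of_mem_interval {a b z : ℝ} (ha : a ≤ z) (hb : z ≤ b) :
    min |a| |b| - RobustnessMeasure.str a b ≤ |z| ∧ |z| ≤ max |a| |b| := by
  refine ⟨?_, abs_le_max_abs_abs ha hb⟩
  rw [RobustnessMeasure.str, sub_le_iff_le_add]
  rcases le_total 0 a with h | h
  · refine (min_le_left _ _).trans ?_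
    rw [abs_of_nonneg h, abs_of_nonneg (h.trans ha)]
    have := le_max_right (min (-a) b) 0
    linarith
  rcases le_total b 0 with h' | h'
  · refine (min_le_right _ _).trans ?_
    rw [abs_of_nonpos h', abs_of_nonpos (hb.trans h')]
    have := le_max_right (min (-a) b) 0
    linarith
  · rw [abs_of_nonpos h, abs_of_nonneg h']
    have := le_max_left (min (-a) b) 0
    have := abs_nonneg z
    linarith

/-- If the interval contains `0`, the lower bound is `0` and the upper one is `max (-a) b`, at most
`b - a`. Otherwise the absolute value is monotone on the interval and `str` vanishes. -/
theorem abs_bounds_width {a b : ℝ} (h : a ≤ b) :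
    max |a| |b| - (min |a| |b| - RobustnessMeasure.str a b) ≤ b - a := by
  rw [RobustnessMeasure.str]
  rcases le_total 0 a with h0 | h0
  · rw [abs_of_nonneg h0, abs_of_nonneg (h0.trans h), max_eq_right h, min_eq_left h,
      max_eq_right ((min_le_left _ _).trans (by linarith))]
    linarith
  rcases le_total b 0 with h' | h'
  · rw [abs_of_nonpos h0, abs_of_nonpos h', max_eq_left (by linarith), min_eq_right (by linarith),
      max_eq_right ((min_le_right _ _).trans (by linarith))]
    linarith
  · rw [abs_of_nonpos h0, abs_of_nonneg h', max_eq_left (le_min (by linarith) h')]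
    have : max (-a) b ≤ b - a := max_le (by linarith) (by linarith)
    linarith

namespace RobustnessMeasure

/-- Monotonicity suffices for all cases but the mean absolute deviation, where the mean is monotone
and so `g - 𝔼 g` lies between `l - 𝔼 u` and `u - 𝔼 l`. The conditional form of the tail mean is
excluded, as it need not be monotone. -/
theorem closed_enclosure {ρ : RobustnessMeasure} (hρ : ρ.LevelValid)
    (hc : ∀ α, ρ ≠ condValueAtRisk α) {l g u : Ω → ℝ} (hl : ∀ w, l w ≤ g w) (hu : ∀ w, g w ≤ u w) :
    ρ.closedLcb Pst l u ≤ ρ.value Pst g ∧ ρ.value Pst g ≤ ρ.closedUcb Pst l u := by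
  have : Nonempty Ω := nonempty_of_isProbabilityMeasure Pst
  have key : ∀ {r : (Ω → ℝ) → ℝ}, IsMonetary r → r l ≤ r g ∧ r g ≤ r u := fun hr =>
    ⟨hr.mono _ _ hl, hr.mono _ _ hu⟩
  cases ρ with
  | expectation => exact key (isMonetary_expectation Pst)
  | worstCase => exact key isMonetary_iInf
  | bestCase => exact key isMonetary_iSup
  | valueAtRisk α => exact key (isMonetary_valueAtRisk Pst hρ.1 hρ.2.le)
  | condValueAtRisk α => exact absurd rfl (hc α)
  | avgValueAtRisk α => exact key (isMonetary_quantileTailMean Pst hρ.1 hρ.2.le)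
  | meanAbsDev =>
    have hE := key (isMonetary_expectation Pst)
    have hb : ∀ w, _ := fun w => abs_bounds_of_mem_interval
      (a := l w - ∫ w', u w' ∂Pst) (b := u w - ∫ w', l w' ∂Pst) (z := g w - ∫ w', g w' ∂Pst)
      (sub_le_sub (hl w) hE.2) (sub_le_sub (hu w) hE.1)
    exact ⟨integral_mono .of_finite .of_finite fun w => (hb w).1,
      integral_mono .of_finite .of_finite fun w => (hb w).2⟩

/-- For the mean absolute deviation, centring adds the mean width to the pointwise width, which is
where `q(a) = 2a` comes from. -/
theorem closed_width {ρ : RobustnessMeasure} (hρ : ρ.LevelValid) {l u : Ω → ℝ} {δ : ℝ}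
    (hlu : ∀ w, l w ≤ u w) (hδ : ∀ w, u w ≤ l w + δ) :
    ρ.closedUcb Pst l u - ρ.closedLcb Pst l u ≤ ρ.q δ := by
  have : Nonempty Ω := nonempty_of_isProbabilityMeasure Pst
  have key : ∀ {r : (Ω → ℝ) → ℝ}, IsMonetary r → r u - r l ≤ δ := fun hr =>
    sub_le_iff_le_add'.2 (hr.le_add hδ)
  cases ρ with
  | expectation => exact key (isMonetary_expectation Pst)
  | worstCase => exact key isMonetary_iInf
  | bestCase => exact key isMonetary_iSup
  | valueAtRisk α => exact key (isMonetary_valueAtRisk Pst hρ.1 hρ.2.le)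
  | condValueAtRisk α => exact key (isMonetary_quantileTailMean Pst hρ.1 hρ.2.le)
  | avgValueAtRisk α => exact key (isMonetary_quantileTailMean Pst hρ.1 hρ.2.le)
  | meanAbsDev =>
    have hE := (isMonetary_expectation Pst).mono _ _ hlu
    have hE' := key (isMonetary_expectation Pst)
    simp only [closedUcb, closedLcb, q]
    rw [← integral_sub .of_finite .of_finite]
    have : ∫ _, 2 * δ ∂Pst = 2 * δ := by simp
    rw [← this]
    refine integral_mono .of_finite .of_finite fun w => ?_
    refine (abs_bounds_width (sub_le_sub (hlu w) hE)).trans ?_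
    have := hδ w
    linarith

end RobustnessMeasure

end Robustness

/-! ### Posterior variance and information gain -/

theorem gram_posSemidef {Z : Type*} {k : Z → Z → ℝ} (hk : (Matrix.of k).PosSemidef) {n : ℕ}
    (z : Fin n → Z) : (gram k z).PosSemidef :=
  hk.submatrix z

theorem kernel_symm {Z : Type*} {k : Z → Z → ℝ} (hk : (Matrix.of k).PosSemidef) (a b : Z) :
    k a b = k b a := by
  have := hk.1.apply a b
  simpa using this.symm

theorem gram_add_posDef {Z : Type*} {k : Z → Z → ℝ} (hk : (Matrix.of k).PosSemidef) {v : ℝ}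
    (hv : 0 < v) {n : ℕ} (z : Fin n → Z) :
    (gram k z + v • (1 : Matrix (Fin n) (Fin n) ℝ)).PosDef :=
  Matrix.PosDef.posSemidef_add (gram_posSemidef hk z) (Matrix.PosDef.one.smul hv)

theorem postVar_le {Z : Type*} {k : Z → Z → ℝ} (hk : (Matrix.of k).PosSemidef) {v : ℝ}
    (hv : 0 < v) {n : ℕ} (z : Fin n → Z) (a : Z) : postVar k v z a ≤ k a a := by
  have := (gram_add_posDef hk hv z).inv.posSemidef.dotProduct_mulVec_nonneg fun j => k a (z j)
  rw [star_trivial] at this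
  rw [postVar]
  linarith

theorem postVar_eq_schur {Z : Type*} {k : Z → Z → ℝ} {v : ℝ} {n : ℕ} (z : Fin n → Z) (a : Z)
    (i j : Fin 1) :
    postVar k v z a = (Matrix.of (fun _ _ : Fin 1 => k a a) -
      (Matrix.of fun i (_ : Fin 1) => k a (z i))ᴴ *
        (gram k z + v • (1 : Matrix (Fin n) (Fin n) ℝ))⁻¹ *
          (Matrix.of fun i (_ : Fin 1) => k a (z i))) i j := by
  rw [Matrix.sub_apply, Matrix.mul_assoc, Matrix.mul_apply, postVar]
  rfl

/-- The posterior variance is the Schur complement of the observed block in the kernel matrix of the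
points `z` and `a`, with `v` added on the diagonal of the observed block only; this matrix is
positive semidefinite. -/
theorem postVar_nonneg {Z : Type*} {k : Z → Z → ℝ} (hk : (Matrix.of k).PosSemidef) {v : ℝ}
    (hv : 0 < v) {n : ℕ} (z : Fin n → Z) (a : Z) : 0 ≤ postVar k v z a := by
  have h1 := hk.submatrix (Sum.elim z fun _ : Fin 1 => a)
  have h2 : (Matrix.diagonal (Sum.elim (fun _ : Fin n => v) fun _ : Fin 1 => 0)).PosSemidef :=
    Matrix.PosSemidef.diagonal fun i => by cases i <;> simp [hv.le]
  have h3 : (Matrix.of k).submatrix (Sum.elim z fun _ : Fin 1 => a)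
        (Sum.elim z fun _ : Fin 1 => a) +
      Matrix.diagonal (Sum.elim (fun _ : Fin n => v) fun _ : Fin 1 => 0) =
      Matrix.fromBlocks (gram k z + v • (1 : Matrix (Fin n) (Fin n) ℝ))
        (Matrix.of fun i (_ : Fin 1) => k a (z i)) (Matrix.of fun i (_ : Fin 1) => k a (z i))ᴴ
        (Matrix.of fun _ _ : Fin 1 => k a a) := by
    ext i j
    rcases i with i | i <;> rcases j with j | j
    · by_cases h : i = j <;> simp [gram, h]
    · simp [kernel_symm hk a]
    · simp
    · simp [Matrix.diagonal_apply]
  have h4 := h1.add h2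
  have hA := gram_add_posDef hk hv z
  let := hA.isUnit.invertible
  rw [h3, Matrix.PosDef.fromBlocks₁₁ _ _ hA] at h4
  rw [postVar_eq_schur z a 0 0]
  exact h4.diag_nonneg

/-- The Schur determinant formula, with the last point as a block of size one. -/
theorem det_gram_succ {Z : Type*} {k : Z → Z → ℝ} (hk : (Matrix.of k).PosSemidef) {v : ℝ}
    (hv : 0 < v) (n : ℕ) (z : ℕ → Z) :
    (gram k (fun i : Fin (n + 1) => z i) + v • (1 : Matrix (Fin (n + 1)) (Fin (n + 1)) ℝ)).det =
      (gram k (fun i : Fin n => z i) + v • (1 : Matrix (Fin n) (Fin n) ℝ)).det *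
        (v + postVar k v (fun i : Fin n => z i) (z n)) := by
  have h : (gram k (fun i : Fin (n + 1) => z i) +
      v • (1 : Matrix (Fin (n + 1)) (Fin (n + 1)) ℝ)).submatrix finSumFinEquiv finSumFinEquiv =
      Matrix.fromBlocks (gram k (fun i : Fin n => z i) + v • (1 : Matrix (Fin n) (Fin n) ℝ))
        (Matrix.of fun i (_ : Fin 1) => k (z n) (z i))
        (Matrix.of fun (i : Fin n) (_ : Fin 1) => k (z n) (z i))ᴴ
        (Matrix.of fun _ _ : Fin 1 => v + k (z n) (z n)) := by
    ext i j
    rcases i with i | i <;> rcases j with j | j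
    · simp [gram, Matrix.one_apply]
    · have : Fin.castAdd 1 i ≠ Fin.natAdd n j := by
        intro h
        have := congrArg Fin.val h
        simp at this
        omega
      simp [gram, kernel_symm hk (z n), this]
    · have : Fin.natAdd n i ≠ Fin.castAdd 1 j := by
        intro h
        have := congrArg Fin.val h
        simp at this
        omega
      simp [gram, this]
    · have : i = j := Subsingleton.elim _ _
      simp [gram, this, add_comm]
  rw [← Matrix.det_submatrix_equiv_self finSumFinEquiv, h]
  have hA := (gram_add_posDef hk hv fun i : Fin n => z i).isUnit
  let := hA.invertible
  rw [Matrix.det_fromBlocks₁₁, Matrix.invOf_eq_nonsing_inv, Matrix.det_fin_one,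
    postVar_eq_schur _ _ 0 0]
  simp only [Matrix.sub_apply, Matrix.of_apply]
  ring

/-- The chain rule for the information gain, in multiplicative form. -/
theorem det_one_add_gram {Z : Type*} {k : Z → Z → ℝ} (hk : (Matrix.of k).PosSemidef) {v : ℝ}
    (hv : 0 < v) (z : ℕ → Z) (n : ℕ) :
    ((1 : Matrix (Fin n) (Fin n) ℝ) + v⁻¹ • gram k (fun i : Fin n => z i)).det =
      ∏ m ∈ Finset.range n, (1 + v⁻¹ * postVar k v (fun i : Fin m => z i) (z m)) := by
  have key : ∀ n, ((1 : Matrix (Fin n) (Fin n) ℝ) + v⁻¹ • gram k (fun i : Fin n => z i)).det =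
      v⁻¹ ^ n * (gram k (fun i : Fin n => z i) + v • (1 : Matrix (Fin n) (Fin n) ℝ)).det := by
    intro n
    have := Matrix.det_smul
      (gram k (fun i : Fin n => z i) + v • (1 : Matrix (Fin n) (Fin n) ℝ)) v⁻¹
    rw [Fintype.card_fin] at this
    rw [← this, smul_add, smul_smul, inv_mul_cancel₀ hv.ne', one_smul, add_comm]
  induction n with
  | zero => simp
  | succ n ih =>
    rw [Finset.prod_range_succ, ← ih, key, key, det_gram_succ hk hv, pow_succ]
    field_simp

/-- Concavity of the logarithm: `1 + c x` is the convex combination of `1` and `1 + c` with weight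
`x`. -/
theorem mul_log_le_log {c x : ℝ} (hc : 0 ≤ c) (h0 : 0 ≤ x) (h1 : x ≤ 1) :
    x * Real.log (1 + c) ≤ Real.log (1 + c * x) := by
  have := strictConcaveOn_log_Ioi.concaveOn.2 (x := 1) (y := 1 + c) (by simp)
    (by simp; linarith) (sub_nonneg.2 h1) h0 (by ring)
  simp only [smul_eq_mul, Real.log_one, mul_zero, zero_add] at this
  refine this.trans_eq ?_
  congr 1
  ring

/-- As `k z z ≤ 1`, the posterior variances lie in `[0, 1]`, where each is at most its information
gain `log (1 + v⁻¹ x)` divided by `log (1 + v⁻¹)`. The gains add up to the log-determinant. -/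
theorem sum_postVar_le {Z : Type*} [Finite Z] {k : Z → Z → ℝ} (hk : (Matrix.of k).PosSemidef)
    (hk1 : ∀ z, k z z ≤ 1) {v : ℝ} (hv : 0 < v) (z : ℕ → Z) (t : ℕ) :
    ∑ n ∈ Finset.range t, postVar k v (fun i : Fin n => z i) (z n) ≤
      2 * maxInfoGain k v t / Real.log (1 + v⁻¹) := by
  have hlog : 0 < Real.log (1 + v⁻¹) := Real.log_pos (by linarith [inv_pos.2 hv])
  have hpos : ∀ n, 0 < 1 + v⁻¹ * postVar k v (fun i : Fin n => z i) (z n) := fun n => by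
    have := mul_nonneg (inv_pos.2 hv).le (postVar_nonneg hk hv (fun i : Fin n => z i) (z n))
    linarith
  rw [le_div_iff₀ hlog, Finset.sum_mul]
  calc ∑ n ∈ Finset.range t, postVar k v (fun i : Fin n => z i) (z n) * Real.log (1 + v⁻¹)
      ≤ ∑ n ∈ Finset.range t, Real.log (1 + v⁻¹ * postVar k v (fun i : Fin n => z i) (z n)) :=
        Finset.sum_le_sum fun n _ => mul_log_le_log (inv_pos.2 hv).le (postVar_nonneg hk hv _ _)
          ((postVar_le hk hv _ _).trans (hk1 _))
    _ = Real.log ((1 : Matrix (Fin t) (Fin t) ℝ) + v⁻¹ • gram k (fun i : Fin t => z i)).det := by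
        rw [det_one_add_gram hk hv, Real.log_prod fun n _ => (hpos n).ne']
    _ ≤ ⨆ z : Fin t → Z, Real.log ((1 : Matrix (Fin t) (Fin t) ℝ) + v⁻¹ • gram k z).det :=
        le_ciSup (f := fun z : Fin t → Z =>
          Real.log ((1 : Matrix (Fin t) (Fin t) ℝ) + v⁻¹ • gram k z).det)
          (Set.finite_range _).bddAbove fun i : Fin t => z i
    _ = 2 * maxInfoGain k v t := by
        rw [maxInfoGain]
        ring

/-! ### Tail bounds -/

theorem isProbabilityMeasure_chiSquared_two : IsProbabilityMeasure (chiSquared 2) :=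
  isProbabilityMeasure_gammaMeasure (by norm_num) (by norm_num)

theorem chiSquared_two_eq : chiSquared 2 = expMeasure (1 / 2) := by
  rw [chiSquared, expMeasure]
  norm_num

theorem chiSquared_two_Ioi {x : ℝ} (hx : 0 ≤ x) :
    chiSquared 2 (Set.Ioi x) = ENNReal.ofReal (Real.exp (-x / 2)) := by
  have := isProbabilityMeasure_chiSquared_two
  have h := cdf_expMeasure_eq (r := 1 / 2) (by norm_num) x
  rw [← chiSquared_two_eq, cdf_eq_real, if_pos hx] at h
  rw [← Set.compl_Iic, ← ofReal_measureReal, probReal_compl_eq_one_sub measurableSet_Iic, h]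
  congr 1
  rw [sub_sub_cancel]
  congr 1
  ring

theorem chiSquared_two_Iio_zero : chiSquared 2 (Set.Iio 0) = 0 := by
  have := isProbabilityMeasure_chiSquared_two
  have h := chiSquared_two_Ioi le_rfl
  rw [neg_zero, zero_div, Real.exp_zero, ENNReal.ofReal_one, 
    ← prob_compl_eq_zero_iff measurableSet_Ioi, Set.compl_Ioi] at h
  exact measure_mono_null Set.Iio_subset_Iic_self h

theorem lintegral_chiSquared_two : ∫⁻ x, ENNReal.ofReal x ∂(chiSquared 2) = 2 := by
  have h0 : 0 ≤ᵐ[chiSquared 2] (id : ℝ → ℝ) := by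
    rw [Filter.EventuallyLE, ae_iff]
    simpa using! chiSquared_two_Iio_zero
  have := lintegral_eq_lintegral_meas_lt (chiSquared 2) h0 aemeasurable_id
  simp only [id] at this
  rw [this, setLIntegral_congr_fun measurableSet_Ioi
    (g := fun x => ENNReal.ofReal (Real.exp (-(1 / 2) * x)))]
  · rw [← ofReal_integral_eq_lintegral_ofReal]
    · rw [integral_exp_mul_Ioi (by norm_num)]
      norm_num
    · exact integrableOn_exp_mul_Ioi (by norm_num) 0
    · exact ae_of_all _ fun x => (Real.exp_pos _).le
  · intro x hx
    have : {a : ℝ | x < a} = Set.Ioi x := rfl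
    simp only
    rw [this, chiSquared_two_Ioi (le_of_lt hx)]
    congr 2
    ring

/-- After a shift by `c`, compare densities using `(x + c)² ≥ x² + c²` for `x ≥ 0`. The factor `ℙ(·
≥ 0)`, which is one half, is kept so that the two-sided bound has constant `1` and matches the tail
of `β`. -/
theorem gaussianReal_Ici_le {c : ℝ} (hc : 0 ≤ c) :
    gaussianReal 0 1 (Set.Ici c) ≤
      ENNReal.ofReal (Real.exp (-c ^ 2 / 2)) * gaussianReal 0 1 (Set.Ici 0) := by
  have h1 : gaussianReal 0 1 (Set.Ici c) = gaussianReal (-c) 1 (Set.Ici 0) := by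
    rw [show -c = 0 + -c by ring, ← gaussianReal_map_add_const,
      Measure.map_apply (by fun_prop) measurableSet_Ici]
    congr 1
    ext x
    simp
  rw [h1, gaussianReal_apply _ one_ne_zero, gaussianReal_apply _ one_ne_zero,
    ← lintegral_const_mul _ (measurable_gaussianPDF 0 1)]
  refine setLIntegral_mono' measurableSet_Ici fun x hx => ?_
  rw [gaussianPDF, gaussianPDF, ← ENNReal.ofReal_mul (Real.exp_pos _).le]
  refine ENNReal.ofReal_le_ofReal ?_
  simp only [gaussianPDFReal]
  rw [mul_left_comm, ← Real.exp_add]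
  refine mul_le_mul_of_nonneg_left (Real.exp_le_exp.2 ?_) (by positivity)
  have := mul_nonneg hc (Set.mem_Ici.1 hx)
  simp only [NNReal.coe_one]
  nlinarith

theorem gaussianReal_two_sided {c : ℝ} (hc : 0 ≤ c) :
    gaussianReal 0 1 {x | c ≤ |x|} ≤ ENNReal.ofReal (Real.exp (-c ^ 2 / 2)) := by
  have hneg : ∀ a : ℝ, gaussianReal 0 1 (Set.Iic (-a)) = gaussianReal 0 1 (Set.Ici a) := fun a => by
    have := gaussianReal_map_neg (μ := 0) (v := 1)
    rw [neg_zero] at this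
    conv_lhs => rw [← this]
    rw [Measure.map_apply measurable_neg measurableSet_Iic]
    congr 1
    ext x
    simp
  have := nullSingletonClass_gaussianReal (μ := 0) (v := 1) one_ne_zero
  have h2 : gaussianReal 0 1 (Set.Ici 0) + gaussianReal 0 1 (Set.Ici 0) = 1 := by
    nth_rewrite 2 [← hneg 0]
    rw [neg_zero, measure_congr (Iio_ae_eq_Iic (a := (0:ℝ))).symm, add_comm,
      ← measure_union _ measurableSet_Ici, Set.Iio_union_Ici, measure_univ]
    exact Set.disjoint_left.2 fun x hx hx' => absurd (Set.mem_Iio.1 hx) (not_lt.2 hx')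
  calc gaussianReal 0 1 {x | c ≤ |x|}
      ≤ gaussianReal 0 1 (Set.Ici c ∪ Set.Iic (-c)) := by
        refine measure_mono fun x hx => ?_
        rcases le_abs.1 (show c ≤ |x| from hx) with h | h
        · exact Or.inl h
        · exact Or.inr (by simp; linarith)
    _ ≤ gaussianReal 0 1 (Set.Ici c) + gaussianReal 0 1 (Set.Iic (-c)) := measure_union_le _ _
    _ = gaussianReal 0 1 (Set.Ici c) + gaussianReal 0 1 (Set.Ici c) := by rw [hneg]
    _ ≤ ENNReal.ofReal (Real.exp (-c ^ 2 / 2)) * gaussianReal 0 1 (Set.Ici 0) +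
        ENNReal.ofReal (Real.exp (-c ^ 2 / 2)) * gaussianReal 0 1 (Set.Ici 0) :=
        add_le_add (gaussianReal_Ici_le hc) (gaussianReal_Ici_le hc)
    _ = ENNReal.ofReal (Real.exp (-c ^ 2 / 2)) := by rw [← mul_add, h2, mul_one]

/-! ### Comparison of a conditional expectation with a randomized upper bound -/

open scoped ENNReal in
/-- Suppose that `G (H, f)` is conditionally given `H` stochastically dominated by `b`, and that
`Φ s` bounds `r (H s, f')` for all `f'` with `G (H s, f') ≤ b s`. Then `𝔼[r (H, f)] ≤ 𝔼[Φ]`. -/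
theorem lintegral_le_lintegral_of_dominated {S T F : Type*} [MeasurableSpace S] [MeasurableSpace T]
    [MeasurableSpace F] [StandardBorelSpace F] [Nonempty F] (P : Measure S) [IsProbabilityMeasure P]
    {H : S → T} (hH : Measurable H) {f : S → F} (hf : Measurable f)
    {G : T → F → ℝ≥0∞} (hG : Measurable (Function.uncurry G))
    {r : T → F → ℝ} (hr : Measurable (Function.uncurry r)) (hr0 : ∀ h f', 0 ≤ r h f')
    {b : S → ℝ≥0∞} {Φ : S → ℝ} (hΦ : Measurable Φ) (hΦ0 : ∀ s, 0 ≤ Φ s)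
    (hdom : ∀ τ : T → ℝ≥0∞, Measurable τ →
      P {s | τ (H s) ≤ G (H s) (f s)} ≤ P {s | τ (H s) < b s})
    (hle : ∀ᵐ s ∂P, ∀ f', G (H s) f' ≤ b s → r (H s) f' ≤ Φ s) :
    ∫⁻ s, ENNReal.ofReal (r (H s) (f s)) ∂P ≤ ∫⁻ s, ENNReal.ofReal (Φ s) ∂P := by
  have hrm : Measurable fun s => r (H s) (f s) := hr.comp (hH.prodMk hf)
  rw [lintegral_eq_lintegral_meas_lt P (ae_of_all _ fun s => hr0 _ _) hrm.aemeasurable,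
    lintegral_eq_lintegral_meas_lt P (ae_of_all _ hΦ0) hΦ.aemeasurable]
  refine lintegral_mono fun x => ?_
  set ν := condDistrib f H P
  let A : ℚ → Set (T × F) := fun q =>
    {p | x < r p.1 p.2 ∧ G p.1 p.2 ≤ ENNReal.ofReal q}
  have hA : ∀ q, MeasurableSet (A q) := fun q =>
    (measurableSet_lt measurable_const hr).inter (measurableSet_le hG measurable_const)
  -- `τ h` is the infimum of the levels `q` for which, given `h`, the event `r > x` with deviation
  -- at most `q` has positive probability. So `r > x` almost surely forces a deviation of at least
  -- `τ H`, while `τ H < b` produces some `f'` of deviation at most `b` with `r > x`, whence `Φ >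
  -- x`. Rational levels make `τ` measurable and leave countably many null sets.
  let τ : T → ℝ≥0∞ := fun h =>
    ⨅ q : ℚ, if ν h (Prod.mk h ⁻¹' A q) = 0 then ⊤ else ENNReal.ofReal q
  have hτ : Measurable τ := Measurable.iInf fun q => Measurable.ite
    (Kernel.measurable_kernel_prodMk_left (hA q) (measurableSet_singleton 0))
    measurable_const measurable_const
  have hnull : P {s | x < r (H s) (f s) ∧ G (H s) (f s) < τ (H s)} = 0 := by
    have hB : MeasurableSet {p : T × F | x < r p.1 p.2 ∧ G p.1 p.2 < τ p.1} :=
      (measurableSet_lt measurable_const hr).inter (measurableSet_lt hG (hτ.comp measurable_fst))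
    have h1 : P {s | x < r (H s) (f s) ∧ G (H s) (f s) < τ (H s)} =
        (P.map fun s => (H s, f s)) {p : T × F | x < r p.1 p.2 ∧ G p.1 p.2 < τ p.1} := by
      rw [Measure.map_apply (hH.prodMk hf) hB]
      rfl
    rw [h1, ← compProd_map_condDistrib hf.aemeasurable, Measure.compProd_apply hB]
    refine lintegral_eq_zero_of_ae_eq_zero (ae_of_all _ fun h => ?_)
    have h2 : Prod.mk h ⁻¹' {p : T × F | x < r p.1 p.2 ∧ G p.1 p.2 < τ p.1} ⊆
        ⋃ q : {q : ℚ // ν h (Prod.mk h ⁻¹' A q) = 0}, Prod.mk h ⁻¹' A q := by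
      rintro f' ⟨hf1, hf2⟩
      obtain ⟨q, -, hq1, hq2⟩ := ENNReal.lt_iff_exists_rat_btwn.1 hf2
      rw [Set.mem_iUnion]
      refine ⟨⟨q, ?_⟩, hf1, hq1.le⟩
      by_contra hne
      have h3 : τ h ≤ ENNReal.ofReal q := (iInf_le _ q).trans (by rw [if_neg hne])
      exact absurd hq2 (not_lt.2 h3)
    exact measure_mono_null h2 (measure_iUnion_null fun q => q.2)
  calc P {s | x < r (H s) (f s)}
      ≤ P ({s | x < r (H s) (f s) ∧ G (H s) (f s) < τ (H s)} ∪ {s | τ (H s) ≤ G (H s) (f s)}) :=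
        measure_mono fun s hs => (lt_or_ge (G (H s) (f s)) (τ (H s))).imp (fun h => ⟨hs, h⟩) id
    _ ≤ 0 + P {s | τ (H s) ≤ G (H s) (f s)} := hnull ▸ measure_union_le _ _
    _ ≤ P {s | τ (H s) < b s} := by
        rw [zero_add]
        exact hdom τ hτ
    _ ≤ P {s | x < Φ s} := by
        refine measure_mono_ae ?_
        filter_upwards [hle] with s hs hτs
        obtain ⟨q, hq⟩ := iInf_lt_iff.1 (show τ (H s) < b s from hτs)
        by_cases hne : ν (H s) (Prod.mk (H s) ⁻¹' A q) = 0
        · rw [if_pos hne] at hq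
          exact absurd hq not_top_lt
        · rw [if_neg hne] at hq
          obtain ⟨f', hf1, hf2⟩ := nonempty_of_measure_ne_zero hne
          exact lt_of_lt_of_le hf1 (hs f' (hf2.trans hq.le))

/-! ### The posterior given observations at fixed points -/

/-- The σ-algebra generated by the sources of randomness with index in `I`. -/
abbrev sourceSup {Z S : Type*} (f : S → Z → ℝ) (ε ξ : ℕ → S → ℝ) (I : Set (Option (ℕ ⊕ ℕ))) :
    MeasurableSpace S :=
  ⨆ i ∈ I, sourceSigma f ε ξ i

section Sources

variable {Z S : Type*} {f : S → Z → ℝ} {ε ξ : ℕ → S → ℝ} {I J : Set (Option (ℕ ⊕ ℕ))}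

theorem sourceSup_mono (h : I ⊆ J) : sourceSup f ε ξ I ≤ sourceSup f ε ξ J :=
  biSup_mono h

theorem sourceSigma_le_sourceSup {i : Option (ℕ ⊕ ℕ)} (h : i ∈ I) :
    sourceSigma f ε ξ i ≤ sourceSup f ε ξ I :=
  le_biSup (sourceSigma f ε ξ) h

theorem measurable_sourceSup_f (h : none ∈ I) : Measurable[sourceSup f ε ξ I] f :=
  Measurable.mono (comap_measurable f) (sourceSigma_le_sourceSup (f := f) (ε := ε) (ξ := ξ) h)
    le_rfl

theorem measurable_sourceSup_noise {n : ℕ} (h : some (Sum.inl n) ∈ I) :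
    Measurable[sourceSup f ε ξ I] (ε n) :=
  Measurable.mono (comap_measurable (ε n))
    (sourceSigma_le_sourceSup (f := f) (ε := ε) (ξ := ξ) h) le_rfl

theorem measurable_sourceSup_xi {n : ℕ} (h : some (Sum.inr n) ∈ I) :
    Measurable[sourceSup f ε ξ I] (ξ n) :=
  Measurable.mono (comap_measurable (ξ n))
    (sourceSigma_le_sourceSup (f := f) (ε := ε) (ξ := ξ) h) le_rfl

end Sources

/-! ### Joint Gaussianity and covariances of the observations. -/

namespace IsModel

variable {Z S : Type*} [Fintype Z] [MeasurableSpace S] {P : Measure S} {k : Z → Z → ℝ} {v : ℝ≥0}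
  {f : S → Z → ℝ} {ε ξ : ℕ → S → ℝ} (hm : IsModel P k v f ε ξ)
include hm

theorem sourceSigma_le (i : Option (ℕ ⊕ ℕ)) : sourceSigma f ε ξ i ≤ ‹MeasurableSpace S› := by
  rcases i with _ | n | n
  · exact hm.measurable_f.comap_le
  · exact (hm.measurable_noise n).comap_le
  · exact (hm.measurable_xi n).comap_le

theorem sourceSup_le (I : Set (Option (ℕ ⊕ ℕ))) : sourceSup f ε ξ I ≤ ‹MeasurableSpace S› :=
  iSup₂_le fun i _ => hm.sourceSigma_le i

theorem indepFun_of_disjoint {I J : Set (Option (ℕ ⊕ ℕ))} (hIJ : Disjoint I J) {E F : Type*}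
    [MeasurableSpace E] [MeasurableSpace F] {A : S → E} {B : S → F}
    (hA : Measurable[sourceSup f ε ξ I] A) (hB : Measurable[sourceSup f ε ξ J] B) :
    IndepFun A B P :=
  indep_of_indep_of_le_left (indep_of_indep_of_le_right
    (indep_iSup_of_disjoint hm.sourceSigma_le hm.indep hIJ) hB.comap_le) hA.comap_le

theorem hasGaussianLaw_f : HasGaussianLaw f P := by
  have h := hm.gaussian.hasGaussianLaw Finset.univ
  let L : (((Finset.univ : Finset Z)) → ℝ) →L[ℝ] (Z → ℝ) :=
    { toFun := fun g z => g ⟨z, Finset.mem_univ z⟩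
      map_add' := fun _ _ => rfl
      map_smul' := fun _ _ => rfl }
  exact h.map_fun L

theorem hasGaussianLaw_noise (n : ℕ) : HasGaussianLaw (fun s (i : Fin n) => ε i s) P := by
  refine iIndepFun.hasGaussianLaw (fun i => (hm.noise_law i).hasGaussianLaw) ?_
  rw [iIndepFun_iff_iIndep]
  exact hm.indep.precomp (g := fun i : Fin n => some (Sum.inl (i : ℕ))) fun i j h => by
    simpa [Fin.ext_iff] using h

theorem indepFun_f_noise (n : ℕ) : IndepFun f (fun s (i : Fin n) => ε i s) P := by
  refine hm.indepFun_of_disjoint (I := {none}) (J := Set.range fun i => some (Sum.inl i)) ?_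
    (measurable_sourceSup_f rfl) ?_
  · simp
  · exact @measurable_pi_lambda _ _ _ (_) _ _ fun i => measurable_sourceSup_noise ⟨(i : ℕ), rfl⟩

theorem memLp_f (a : Z) : MemLp (fun s => f s a) 2 P :=
  (hm.hasGaussianLaw_f.eval (X := fun a s => f s a) a).memLp_two

theorem memLp_noise (i : ℕ) : MemLp (ε i) 2 P :=
  (hm.noise_law i).hasGaussianLaw.memLp_two

theorem hasGaussianLaw_prod (n : ℕ) :
    HasGaussianLaw (fun s => (f s, fun i : Fin n => ε i s)) P :=
  (hm.indepFun_f_noise n).hasGaussianLaw hm.hasGaussianLaw_f (hm.hasGaussianLaw_noise n)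

theorem cov_f_noise (a : Z) (i : ℕ) : cov[fun s => f s a, ε i; P] = 0 := by
  have h : IndepFun f (ε i) P := hm.indepFun_of_disjoint (I := {none}) (J := {some (Sum.inl i)})
    (by simp) (measurable_sourceSup_f rfl) (measurable_sourceSup_noise rfl)
  exact (h.comp (measurable_pi_apply a) measurable_id).covariance_eq_zero (hm.memLp_f a)
    (hm.memLp_noise i)

theorem cov_noise (i j : ℕ) : cov[ε i, ε j; P] = if i = j then (v : ℝ) else 0 := by
  split_ifs with h
  · subst h
    rw [covariance_self (hm.measurable_noise i).aemeasurable, (hm.noise_law i).variance_eq,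
      variance_id_gaussianReal]
  · have h : IndepFun (ε i) (ε j) P := hm.indepFun_of_disjoint (I := {some (Sum.inl i)})
      (J := {some (Sum.inl j)}) (by simpa using h) (measurable_sourceSup_noise rfl)
      (measurable_sourceSup_noise rfl)
    exact h.covariance_eq_zero (hm.memLp_noise i) (hm.memLp_noise j)

variable [IsProbabilityMeasure P]

theorem cov_f_obs (a b : Z) (i : ℕ) : cov[fun s => f s a, fun s => f s b + ε i s; P] = k a b := by
  have := covariance_add_right (hm.memLp_f a) (hm.memLp_f b) (hm.memLp_noise i)
  rw [hm.covariance_eq, hm.cov_f_noise, add_zero] at this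
  exact this

theorem cov_obs_obs (a b : Z) (i j : ℕ) :
    cov[fun s => f s a + ε i s, fun s => f s b + ε j s; P] =
      k a b + if i = j then (v : ℝ) else 0 := by
  have h1 := covariance_add_left (hm.memLp_f a) (hm.memLp_noise i)
    ((hm.memLp_f b).add (hm.memLp_noise j))
  have h2 := covariance_add_right (hm.memLp_noise i) (hm.memLp_f b) (hm.memLp_noise j)
  rw [covariance_comm (ε i) fun s => f s b, hm.cov_f_noise, hm.cov_noise, zero_add] at h2
  rw [h2] at h1
  exact h1.trans (by rw [← hm.cov_f_obs a b j]; rfl)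

end IsModel

/-- The noisy observations of `f` at the points `z`. -/
abbrev noisyObs {Z S : Type*} (f : S → Z → ℝ) (ε : ℕ → S → ℝ) {n : ℕ} (z : Fin n → Z) (s : S)
    (i : Fin n) : ℝ :=
  f s (z i) + ε i s

/-- The coefficients of the posterior mean as a linear function of the observations. -/
noncomputable def postCoeff {Z : Type*} (k : Z → Z → ℝ) (v : ℝ) {n : ℕ} (z : Fin n → Z) (a : Z) :
    Fin n → ℝ :=
  (fun j => k a (z j)) ᵥ* (gram k z + v • (1 : Matrix (Fin n) (Fin n) ℝ))⁻¹

theorem postMean_eq_sum {Z : Type*} (k : Z → Z → ℝ) (v : ℝ) {n : ℕ} (z : Fin n → Z) (a : Z)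
    (y : Fin n → ℝ) : postMean k v z y a = ∑ j, postCoeff k v z a j * y j := by
  rw [postMean, Matrix.dotProduct_mulVec]
  rfl

theorem postVar_eq_sum {Z : Type*} (k : Z → Z → ℝ) (v : ℝ) {n : ℕ} (z : Fin n → Z) (a : Z) :
    postVar k v z a = k a a - ∑ j, postCoeff k v z a j * k a (z j) := by
  rw [postVar, Matrix.dotProduct_mulVec]
  rfl

/-- The normal equations of linear prediction; they make the residual uncorrelated with every
observation. -/
theorem sum_postCoeff {Z : Type*} {k : Z → Z → ℝ} (hk : (Matrix.of k).PosSemidef) {v : ℝ}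
    (hv : 0 < v) {n : ℕ} (z : Fin n → Z) (a : Z) (i : Fin n) :
    ∑ j, postCoeff k v z a j * (k (z j) (z i) + if (j : ℕ) = i then v else 0) = k a (z i) := by
  have hA := (gram_add_posDef hk hv z).isUnit
  have h : postCoeff k v z a ᵥ* (gram k z + v • (1 : Matrix (Fin n) (Fin n) ℝ)) =
      fun j => k a (z j) := by
    rw [postCoeff, Matrix.vecMul_vecMul,
      Matrix.nonsing_inv_mul _ ((Matrix.isUnit_iff_isUnit_det _).1 hA), Matrix.vecMul_one]
  rw [← congrFun h i]
  refine Finset.sum_congr rfl fun j _ => ?_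
  simp [gram, Matrix.one_apply, Fin.ext_iff]

/-! ### The residual of the posterior mean. -/

namespace IsModel

variable {Z S : Type*} [Fintype Z] [MeasurableSpace S] {P : Measure S}
  {k : Z → Z → ℝ} {v : ℝ≥0} {f : S → Z → ℝ} {ε ξ : ℕ → S → ℝ} (hm : IsModel P k v f ε ξ)
  {n : ℕ} (z : Fin n → Z) (a : Z)
include hm

/-- The deviation of `f a` from the posterior mean and the observations are jointly Gaussian. -/
theorem hasGaussianLaw_residual :
    HasGaussianLaw (fun s => ((fun _ : Unit => f s a - postMean k v z (noisyObs f ε z s) a),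
      noisyObs f ε z s)) P := by
  -- A linear image of the Gaussian vector formed by `f` and the noise. The residual is written as a
  -- family over `Unit` so that independence can later be read off from the covariances of the
  -- coordinates of two families.
  let L : (Z → ℝ) × (Fin n → ℝ) →ₗ[ℝ] (Unit → ℝ) × (Fin n → ℝ) :=
    { toFun := fun p => ((fun _ => p.1 a - ∑ j, postCoeff k v z a j * (p.1 (z j) + p.2 j)),
        fun i => p.1 (z i) + p.2 i)
      map_add' := fun p q => by
        ext i
        · simp only [Prod.fst_add, Prod.snd_add, Pi.add_apply, mul_add, Finset.sum_add_distrib]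
          ring
        · simp only [Prod.fst_add, Prod.snd_add, Pi.add_apply]
          ring
      map_smul' := fun c p => by
        ext i
        · simp only [Prod.smul_fst, Prod.smul_snd, Pi.smul_apply, smul_eq_mul, RingHom.id_apply,
            mul_sub, Finset.mul_sum]
          congr 1
          refine Finset.sum_congr rfl fun j _ => ?_
          ring
        · simp only [Prod.smul_fst, Prod.smul_snd, Pi.smul_apply, smul_eq_mul, RingHom.id_apply]
          ring }
  have h := (hm.hasGaussianLaw_prod n).map_fun L.toContinuousLinearMap
  simp only [postMean_eq_sum]
  exact h

theorem memLp_noisyObs (i : Fin n) : MemLp (fun s => noisyObs f ε z s i) 2 P :=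
  (hm.memLp_f (z i)).add (hm.memLp_noise i)

theorem memLp_postMean : MemLp (fun s => postMean k v z (noisyObs f ε z s) a) 2 P := by
  simp only [postMean_eq_sum]
  exact memLp_finsetSum _ fun j _ => (hm.memLp_noisyObs z j).const_mul _

variable [IsProbabilityMeasure P]

theorem cov_residual {W : S → ℝ} (hW : MemLp W 2 P) :
    cov[fun s => f s a - postMean k v z (noisyObs f ε z s) a, W; P] =
      cov[fun s => f s a, W; P] -
        ∑ j, postCoeff k v z a j * cov[fun s => noisyObs f ε z s j, W; P] := by
  rw [covariance_fun_sub_left (hm.memLp_f a) (hm.memLp_postMean z a) hW]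
  simp only [postMean_eq_sum]
  rw [covariance_fun_sum_left (fun j => (hm.memLp_noisyObs z j).const_mul _) hW]
  simp only [covariance_const_mul_left]

theorem cov_residual_obs (hv : 0 < v) (i : Fin n) :
    cov[fun s => f s a - postMean k v z (noisyObs f ε z s) a, fun s => noisyObs f ε z s i; P] =
      0 := by
  rw [hm.cov_residual z a (hm.memLp_noisyObs z i), hm.cov_f_obs]
  simp only [hm.cov_obs_obs]
  rw [sum_postCoeff hm.kernel_posSemidef (NNReal.coe_pos.2 hv), sub_self]

/-- The residual is uncorrelated with the observations, so its variance is its covariance with `f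
a`. -/
theorem variance_residual (hv : 0 < v) :
    Var[fun s => f s a - postMean k v z (noisyObs f ε z s) a; P] = postVar k v z a := by
  have hD : MemLp (fun s => f s a - postMean k v z (noisyObs f ε z s) a) 2 P :=
    (hm.memLp_f a).sub (hm.memLp_postMean z a)
  have h1 : cov[fun s => f s a, fun s => f s a - postMean k v z (noisyObs f ε z s) a; P] =
      postVar k v z a := by
    rw [covariance_comm, hm.cov_residual z a (hm.memLp_f a), hm.covariance_eq, postVar_eq_sum]
    congr 1
    refine Finset.sum_congr rfl fun j _ => ?_
    rw [covariance_comm, hm.cov_f_obs]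
  rw [← covariance_self hD.aemeasurable, hm.cov_residual z a hD, h1]
  have h2 : ∀ j : Fin n, cov[fun s => noisyObs f ε z s j,
      fun s => f s a - postMean k v z (noisyObs f ε z s) a; P] = 0 := fun j => by
    rw [covariance_comm, hm.cov_residual_obs z a hv]
  exact sub_eq_self.2 (Finset.sum_eq_zero fun j _ => by rw [h2 j, mul_zero])

theorem integral_residual :
    ∫ s, f s a - postMean k v z (noisyObs f ε z s) a ∂P = 0 := by
  have hf : ∀ b, Integrable (fun s => f s b) P := fun b => (hm.memLp_f b).integrable one_le_two
  have hε : ∀ i, Integrable (ε i) P := fun i => (hm.memLp_noise i).integrable one_le_two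
  have hε0 : ∀ i, ∫ s, ε i s ∂P = 0 := fun i => by
    rw [(hm.noise_law i).integral_eq, integral_id_gaussianReal]
  rw [integral_sub (hf a) ((hm.memLp_postMean z a).integrable one_le_two), hm.mean_zero]
  simp only [postMean_eq_sum]
  rw [integral_finsetSum _ fun j _ =>
    ((hm.memLp_noisyObs z j).integrable one_le_two).const_mul _]
  simp only [integral_const_mul]
  simp [integral_add, hf, hε, hm.mean_zero, hε0]

theorem map_residual (hv : 0 < v) :
    P.map (fun s => f s a - postMean k v z (noisyObs f ε z s) a) =
      gaussianReal 0 (postVar k v z a).toNNReal := by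
  have h := ((hm.hasGaussianLaw_residual z a).fst.eval
    (X := fun (_ : Unit) s => f s a - postMean k v z (noisyObs f ε z s) a) ()).map_eq_gaussianReal
  rw [hm.variance_residual z a hv, hm.integral_residual z a] at h
  exact h

/-- Uncorrelated components of a jointly Gaussian vector are independent. Together with
`map_residual` this takes the place of computing the conditional law of `f a`. -/
theorem indepFun_residual_obs (hv : 0 < v) :
    IndepFun (fun s => f s a - postMean k v z (noisyObs f ε z s) a) (noisyObs f ε z) P := by
  have h := (hm.hasGaussianLaw_residual z a).indepFun_of_covariance_eval
    (X := fun (_ : Unit) s => f s a - postMean k v z (noisyObs f ε z s) a)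
    (Y := fun i s => noisyObs f ε z s i) fun _ i => hm.cov_residual_obs z a hv i
  exact h.comp (measurable_pi_apply ()) measurable_id

end IsModel

open scoped ENNReal

/-! ### Conditional tail bounds -/

/-- The tail `exp (-t / 2)` of the chi-squared distribution with two degrees of freedom. -/
noncomputable def expTail (t : ℝ≥0∞) : ℝ≥0∞ :=
  if t = ⊤ then 0 else ENNReal.ofReal (Real.exp (-t.toReal / 2))

theorem measurable_expTail : Measurable expTail :=
  Measurable.ite (measurableSet_singleton _) measurable_const (by fun_prop)

/-- Rescaling by `√V` reduces to the standard Gaussian. For `V ≤ 0` the law is the point mass at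
`0`, and the convention `0 / 0 = 0` makes the normalized deviation vanish. -/
theorem gaussianReal_normalized_tail (V : ℝ) (t : ℝ≥0∞) :
    gaussianReal 0 V.toNNReal {d | t ≤ ENNReal.ofReal (d ^ 2) / ENNReal.ofReal V} ≤ expTail t := by
  rcases le_or_gt V 0 with hV | hV
  · rw [Real.toNNReal_of_nonpos hV, gaussianReal_zero_var]
    rcases eq_or_ne t 0 with rfl | ht
    · simp [expTail]
    · refine le_trans (le_of_eq ?_) zero_le
      have hms : MeasurableSet {d : ℝ | t ≤ ENNReal.ofReal (d ^ 2) / ENNReal.ofReal V} :=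
        measurableSet_le measurable_const (by fun_prop)
      rw [Measure.dirac_apply' _ hms]
      simpa using ht
  · have h1 : gaussianReal 0 V.toNNReal = (gaussianReal 0 1).map (√V * ·) := by
      rw [gaussianReal_map_const_mul]
      congr 1
      · simp
      · ext
        simp [Real.sq_sqrt hV.le, hV.le]
    have hms : MeasurableSet {d : ℝ | t ≤ ENNReal.ofReal (d ^ 2) / ENNReal.ofReal V} :=
      measurableSet_le measurable_const (by fun_prop)
    rw [h1, Measure.map_apply (by fun_prop) hms]
    have h2 : (√V * ·) ⁻¹' {d : ℝ | t ≤ ENNReal.ofReal (d ^ 2) / ENNReal.ofReal V} =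
        {d : ℝ | t ≤ ENNReal.ofReal (d ^ 2)} := by
      ext d
      simp only [Set.mem_preimage, Set.mem_ofPred_eq]
      rw [mul_pow, Real.sq_sqrt hV.le, ENNReal.ofReal_mul hV.le, mul_comm,
        ENNReal.mul_div_cancel_right (by simpa using hV) ENNReal.ofReal_ne_top]
    rw [h2, expTail]
    split_ifs with ht
    · simp [ht]
    · refine le_trans (measure_mono fun d hd => ?_)
        ((gaussianReal_two_sided (Real.sqrt_nonneg t.toReal)).trans_eq ?_)
      · have : t.toReal ≤ d ^ 2 := by
          rw [Set.mem_ofPred_eq] at hd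
          exact ENNReal.toReal_le_of_le_ofReal (sq_nonneg d) hd
        rw [Set.mem_ofPred_eq, ← Real.sqrt_sq_eq_abs]
        exact Real.sqrt_le_sqrt this
      · rw [Real.sq_sqrt ENNReal.toReal_nonneg]

/-- By independence and Fubini, `K` can be frozen and the Gaussian tail bound applied at the level
`τ (K s)`. The set `C` will encode the event that the evaluation points follow a given sequence. -/
theorem measure_normalized_tail_le {S T : Type*} [MeasurableSpace S] [MeasurableSpace T]
    {P : Measure S} [IsProbabilityMeasure P] {K : S → T} (hK : Measurable K) {D : S → ℝ}
    (hD : Measurable D) (hDK : IndepFun D K P) {V : ℝ}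
    (hlaw : P.map D = gaussianReal 0 V.toNNReal) {C : Set T} (hC : MeasurableSet C)
    {τ : T → ℝ≥0∞} (hτ : Measurable τ) :
    P {s | K s ∈ C ∧ τ (K s) ≤ ENNReal.ofReal (D s ^ 2) / ENNReal.ofReal V} ≤
      ∫⁻ s in K ⁻¹' C, expTail (τ (K s)) ∂P := by
  have hB : MeasurableSet {p : T × ℝ | p.1 ∈ C ∧
      τ p.1 ≤ ENNReal.ofReal (p.2 ^ 2) / ENNReal.ofReal V} :=
    (measurable_fst hC).inter (measurableSet_le (hτ.comp measurable_fst) (by fun_prop))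
  have hmap := (indepFun_iff_map_prod_eq_prod_map_map hK.aemeasurable hD.aemeasurable).1 hDK.symm
  have h1 : P {s | K s ∈ C ∧ τ (K s) ≤ ENNReal.ofReal (D s ^ 2) / ENNReal.ofReal V} =
      (P.map fun s => (K s, D s)) {p : T × ℝ | p.1 ∈ C ∧
        τ p.1 ≤ ENNReal.ofReal (p.2 ^ 2) / ENNReal.ofReal V} := by
    rw [Measure.map_apply (hK.prodMk hD) hB]
    rfl
  rw [h1, hmap, hlaw, Measure.prod_apply hB, ← lintegral_indicator (hK hC)]
  have h2 : ∫⁻ s, (K ⁻¹' C).indicator (fun s => expTail (τ (K s))) s ∂P =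
      ∫⁻ h, C.indicator (fun h => expTail (τ h)) h ∂(P.map K) := by
    rw [lintegral_map (f := C.indicator fun h => expTail (τ h))
      ((measurable_expTail.comp hτ).indicator hC) hK]
    rfl
  rw [h2]
  refine lintegral_mono fun h => ?_
  by_cases hh : h ∈ C
  · rw [Set.indicator_of_mem hh]
    refine (measure_mono fun d hd => ?_).trans (gaussianReal_normalized_tail V (τ h))
    exact hd.2
  · rw [Set.indicator_of_notMem hh]
    refine (measure_mono_null (fun d hd => ?_) measure_empty).le
    exact hh hd.1

theorem indepFun_prodMk_of_indepFun {S A B C : Type*} [MeasurableSpace S] [MeasurableSpace A]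
    [MeasurableSpace B] [MeasurableSpace C] {P : Measure S} [IsProbabilityMeasure P]
    {D : S → A} {Y : S → B} {W : S → C} (hD : Measurable D) (hY : Measurable Y)
    (hW : Measurable W) (h1 : IndepFun D Y P) (h2 : IndepFun (fun s => (D s, Y s)) W P) :
    IndepFun D (fun s => (Y s, W s)) P := by
  have hYW : IndepFun Y W P := h2.comp measurable_snd measurable_id
  rw [indepFun_iff_map_prod_eq_prod_map_map (by fun_prop) (by fun_prop)] at *
  have h3 : P.map (fun s => (D s, Y s, W s)) =
      (P.map fun s => ((D s, Y s), W s)).map MeasurableEquiv.prodAssoc := by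
    rw [Measure.map_map (by fun_prop) (by fun_prop)]
    rfl
  rw [h3, h2, h1, Measure.prodAssoc_prod, hYW]

/-! ### The data of the algorithm -/

section Data

variable {X Ω S : Type*} [Fintype X] [Fintype Ω]

/-- The data `(x, w, y, β)` of the iterations `0, …, n - 1`. -/
noncomputable abbrev data (f : S → X × Ω → ℝ) (ε ξ : ℕ → S → ℝ) (x : ℕ → S → X) (w : ℕ → S → Ω)
    (n : ℕ) (s : S) (i : Fin n) : X × Ω × ℝ × ℝ :=
  (x i s, w i s, obs f ε x w i s, beta X Ω ξ i s)

/-- The evaluation points recorded in the data `h`. -/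
abbrev dataPts {X Ω : Type*} {n : ℕ} (h : Fin n → X × Ω × ℝ × ℝ) (i : Fin n) : X × Ω :=
  ((h i).1, (h i).2.1)

/-- The observations recorded in the data `h`. -/
abbrev dataObs {X Ω : Type*} {n : ℕ} (h : Fin n → X × Ω × ℝ × ℝ) (i : Fin n) : ℝ := (h i).2.2.1

/-- The squared deviation of `g a` from the posterior mean in units of the posterior variance,
given the data `h`. -/
noncomputable def deviation {X Ω : Type*} (k : X × Ω → X × Ω → ℝ) (v : ℝ≥0) {n : ℕ}
    (h : Fin n → X × Ω × ℝ × ℝ) (g : X × Ω → ℝ) (a : X × Ω) : ℝ≥0∞ :=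
  ENNReal.ofReal ((g a - postMean k v (dataPts h) (dataObs h) a) ^ 2) /
    ENNReal.ofReal (postVar k v (dataPts h) a)

variable {f : S → X × Ω → ℝ} {ε ξ : ℕ → S → ℝ} {x : ℕ → S → X} {w : ℕ → S → Ω}

/-- The sources of randomness which determine the data of the iterations `0, …, n - 1`. -/
def pastSources (n : ℕ) : Set (Option (ℕ ⊕ ℕ)) := {i | ∀ j, n ≤ j → i ≠ some (Sum.inr j)}

theorem pastSources_mono {m n : ℕ} (h : m ≤ n) : pastSources m ⊆ pastSources n :=
  fun _ hi j hj => hi j (h.trans hj)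

theorem measurable_beta_pastSources (n : ℕ) :
    Measurable[sourceSup f ε ξ (pastSources (n + 1))] (beta X Ω ξ n) := by
  have h : some (Sum.inr n) ∈ pastSources (n + 1) := fun j hj h => by
    simp only [Option.some.injEq, Sum.inr.injEq] at h
    omega
  exact (measurable_sourceSup_xi (f := f) (ε := ε) (ξ := ξ) h).const_add _

/-- The observations and the random parts of the `β`s, if the evaluation points are `z`. -/
abbrev pathObs (f : S → X × Ω → ℝ) (ε ξ : ℕ → S → ℝ) (z : ℕ → X × Ω) (n : ℕ) (s : S) :
    (Fin n → ℝ) × (Fin n → ℝ) :=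
  (noisyObs f ε (fun i : Fin n => z i) s, fun i : Fin n => ξ i s)

/-- The data as a function of `pathObs`, if the evaluation points are `z`. -/
noncomputable abbrev pathData (z : ℕ → X × Ω) (n : ℕ) (p : (Fin n → ℝ) × (Fin n → ℝ))
    (i : Fin n) : X × Ω × ℝ × ℝ :=
  ((z i).1, (z i).2, p.1 i, 2 * Real.log (Fintype.card (X × Ω)) + p.2 i)

theorem data_eq_pathData {z : ℕ → X × Ω} {n : ℕ} {s : S}
    (h : ∀ i < n, (x i s, w i s) = z i) :
    data f ε ξ x w n s = pathData z n (pathObs f ε ξ z n s) := by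
  funext i
  simp [data, obs, beta, ← h i i.2]

theorem comap_pathObs_le_succ {X Ω S : Type*} {f : S → X × Ω → ℝ} {ε ξ : ℕ → S → ℝ}
    (z : ℕ → X × Ω) (n : ℕ) :
    MeasurableSpace.comap (pathObs f ε ξ z n) inferInstance ≤
      MeasurableSpace.comap (pathObs f ε ξ z (n + 1)) inferInstance := by
  let r : (Fin (n + 1) → ℝ) × (Fin (n + 1) → ℝ) → (Fin n → ℝ) × (Fin n → ℝ) :=
    fun p => (fun i => p.1 i.castSucc, fun i => p.2 i.castSucc)
  have hr : Measurable r := by fun_prop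
  exact (hr.comp (comap_measurable (pathObs f ε ξ z (n + 1)))).comap_le

variable [MeasurableSpace X] [MeasurableSpace Ω]

theorem history_eq_comap (n : ℕ) :
    history f ε ξ x w n = MeasurableSpace.comap (data f ε ξ x w n) inferInstance := by
  simp only [history, MeasurableSpace.pi, MeasurableSpace.comap_iSup, MeasurableSpace.comap_comp]
  rfl

theorem history_sup_eq_comap (n : ℕ) :
    history f ε ξ x w n ⊔ MeasurableSpace.comap (beta X Ω ξ n) inferInstance =
      MeasurableSpace.comap (fun s => (data f ε ξ x w n s, beta X Ω ξ n s)) inferInstance := by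
  rw [history_eq_comap]
  exact (MeasurableSpace.comap_prodMk _ _).symm

theorem history_sup_le (n : ℕ) (h : history f ε ξ x w n ≤ sourceSup f ε ξ (pastSources n)) :
    history f ε ξ x w n ⊔ MeasurableSpace.comap (beta X Ω ξ n) inferInstance ≤
      sourceSup f ε ξ (pastSources (n + 1)) :=
  sup_le (h.trans (sourceSup_mono (pastSources_mono n.le_succ)))
    (measurable_beta_pastSources n).comap_le

theorem measurable_pathData (z : ℕ → X × Ω) (n : ℕ) : Measurable (pathData z n) := by
  fun_prop

variable [MeasurableSingletonClass X] [MeasurableSingletonClass Ω]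

theorem measurable_postMean_data {X Ω : Type*} [Countable X] [Countable Ω] [MeasurableSpace X]
    [MeasurableSpace Ω] [MeasurableSingletonClass X] [MeasurableSingletonClass Ω]
    (k : X × Ω → X × Ω → ℝ) (v : ℝ≥0) (n : ℕ) (a : X × Ω) :
    Measurable fun h : Fin n → X × Ω × ℝ × ℝ => postMean k v (dataPts h) (dataObs h) a := by
  have h1 : Measurable fun p : (Fin n → X × Ω) × (Fin n → ℝ) => postMean k v p.1 p.2 a := by
    refine measurable_from_prod_countable_right fun z => ?_
    simp only [postMean_eq_sum]
    fun_prop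
  have h2 : Measurable fun h : Fin n → X × Ω × ℝ × ℝ => (dataPts h, dataObs h) := by
    fun_prop
  exact h1.comp h2

theorem measurable_postVar_data {X Ω : Type*} [Countable X] [Countable Ω] [MeasurableSpace X]
    [MeasurableSpace Ω] [MeasurableSingletonClass X] [MeasurableSingletonClass Ω]
    (k : X × Ω → X × Ω → ℝ) (v : ℝ≥0) (n : ℕ) (a : X × Ω) :
    Measurable fun h : Fin n → X × Ω × ℝ × ℝ => postVar k v (dataPts h) a := by
  have h1 : Measurable fun z : Fin n → X × Ω => postVar k v z a := measurable_of_countable _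
  have h2 : Measurable fun h : Fin n → X × Ω × ℝ × ℝ => dataPts h := by
    fun_prop
  exact h1.comp h2

theorem measurable_deviation {X Ω : Type*} [Countable X] [Countable Ω] [MeasurableSpace X]
    [MeasurableSpace Ω] [MeasurableSingletonClass X] [MeasurableSingletonClass Ω]
    (k : X × Ω → X × Ω → ℝ) (v : ℝ≥0) (n : ℕ) (a : X × Ω) :
    Measurable fun p : (Fin n → X × Ω × ℝ × ℝ) × (X × Ω → ℝ) => deviation k v p.1 p.2 a := by
  have h1 : Measurable fun p : (Fin n → X × Ω × ℝ × ℝ) × (X × Ω → ℝ) =>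
      postMean k v (dataPts p.1) (dataObs p.1) a :=
    (measurable_postMean_data k v n a).comp measurable_fst
  have h2 : Measurable fun p : (Fin n → X × Ω × ℝ × ℝ) × (X × Ω → ℝ) =>
      postVar k v (dataPts p.1) a :=
    (measurable_postVar_data k v n a).comp measurable_fst
  have h3 : Measurable fun p : (Fin n → X × Ω × ℝ × ℝ) × (X × Ω → ℝ) => p.2 a := by fun_prop
  exact ((h3.sub h1).pow_const 2).ennreal_ofReal.div h2.ennreal_ofReal

theorem measurable_eval_index {S Z : Type*} {mS : MeasurableSpace S} [Countable Z]
    [MeasurableSpace Z] [MeasurableSingletonClass Z] {g : S → Z → ℝ} {p : S → Z}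
    (hg : Measurable g) (hp : Measurable p) : Measurable fun s => g s (p s) := by
  have h : Measurable fun q : (Z → ℝ) × Z => q.1 q.2 :=
    measurable_from_prod_countable_left fun z => measurable_pi_apply z
  exact h.comp (hg.prodMk hp)

variable
  (hx : ∀ n, Measurable[history f ε ξ x w n ⊔
    MeasurableSpace.comap (beta X Ω ξ n) inferInstance] (x n))
  (hw : ∀ n, Measurable[history f ε ξ x w n ⊔
    MeasurableSpace.comap (beta X Ω ξ n) inferInstance] (w n))

-- The points of iteration `i` depend on earlier data and `β i` only, so by strong induction the
-- data before iteration `n` involve no `ξ j` with `j ≥ n`. Hence they are independent of `β n`.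
include hx hw in
theorem history_le_sourceSup (n : ℕ) :
    history f ε ξ x w n ≤ sourceSup f ε ξ (pastSources n) := by
  induction n using Nat.strong_induction_on with
  | _ n ih =>
  refine iSup_le fun i => ?_
  refine le_trans ?_ (sourceSup_mono (pastSources_mono (Nat.succ_le_of_lt i.2)))
  have hle := history_sup_le i (ih i i.2)
  have h1 := (hx i).mono hle le_rfl
  have h2 := (hw i).mono hle le_rfl
  have hf : Measurable[sourceSup f ε ξ (pastSources (i + 1))] f :=
    measurable_sourceSup_f fun j _ h => by simp at h
  have hε : Measurable[sourceSup f ε ξ (pastSources (i + 1))] (ε i) :=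
    measurable_sourceSup_noise fun j _ h => by simp at h
  exact (h1.prodMk (h2.prodMk (((measurable_eval_index hf (h1.prodMk h2)).add hε).prodMk
    (measurable_beta_pastSources i)))).comap_le

include hx hw in
theorem measurable_data_sourceSup (n : ℕ) :
    Measurable[sourceSup f ε ξ (pastSources n)] (data f ε ξ x w n) := by
  rw [measurable_iff_comap_le, ← history_eq_comap]
  exact history_le_sourceSup hx hw n

/-! ### Decomposition along the evaluation points -/

-- As long as the points have followed `z`, the data are a function of the observations at the fixed
-- points `z` and of the `ξ`s, and together with `β n` they decide whether the next point is `z n`.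
-- The event is therefore determined by variables independent of the residual at fixed points.
include hx hw in
theorem measurableSet_path (z : ℕ → X × Ω) (n : ℕ) :
    MeasurableSet[MeasurableSpace.comap (pathObs f ε ξ z n) inferInstance]
      {s | ∀ i < n, (x i s, w i s) = z i} := by
  induction n with
  | zero => simp
  | succ n ih =>
    have h1 : MeasurableSet[MeasurableSpace.comap
        (fun s => (data f ε ξ x w n s, beta X Ω ξ n s)) inferInstance]
        {s | (x n s, w n s) = z n} := by
      rw [← history_sup_eq_comap]
      exact ((hx n).prodMk (hw n)) (measurableSet_singleton (z n))
    -- `V` collects the values of the data and `β n` for which the next point is `z n`. On the path,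
    -- though not off it, the data may be replaced by `pathData`.
    obtain ⟨V, hV, hVe⟩ := h1
    have h2 : {s | ∀ i < n + 1, (x i s, w i s) = z i} =
        {s | ∀ i < n, (x i s, w i s) = z i} ∩
          (fun s => (pathData z n (pathObs f ε ξ z n s), beta X Ω ξ n s)) ⁻¹' V := by
      ext s
      simp only [Set.mem_inter_iff, Set.mem_preimage, Set.mem_ofPred_eq, Nat.forall_lt_succ_right]
      refine and_congr_right fun hs => ?_
      have h3 : s ∈ {s | (x n s, w n s) = z n} ↔
          s ∈ (fun s => (data f ε ξ x w n s, beta X Ω ξ n s)) ⁻¹' V := by rw [hVe]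
      rw [Set.mem_preimage, data_eq_pathData hs] at h3
      exact h3
    rw [h2]
    have hle := comap_pathObs_le_succ (f := f) (ε := ε) (ξ := ξ) z n
    refine MeasurableSet.inter (hle _ ih) ?_
    have h4 : Measurable[MeasurableSpace.comap (pathObs f ε ξ z (n + 1)) inferInstance]
        (beta X Ω ξ n) := by
      have hr : Measurable fun p : (Fin (n + 1) → ℝ) × (Fin (n + 1) → ℝ) =>
        2 * Real.log (Fintype.card (X × Ω)) + p.2 (Fin.last n) := by fun_prop
      exact hr.comp (comap_measurable (pathObs f ε ξ z (n + 1)))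
    have h5 : Measurable[MeasurableSpace.comap (pathObs f ε ξ z (n + 1)) inferInstance]
        fun s => pathData z n (pathObs f ε ξ z n s) :=
      ((measurable_pathData z n).comp (comap_measurable (pathObs f ε ξ z n))).mono hle le_rfl
    exact (h5.prodMk h4) hV

end Data

/-! ### Domination of the deviations by `β` -/

/-- The reason for the shift `2 log N` in `β`: it multiplies the tail `exp (-t / 2)` by `N`, the
number of terms in the union bound. -/
theorem min_one_le_chiSquared_two {N : ℕ} (hN : N ≠ 0) (t : ℝ≥0∞) :
    min 1 (N * expTail t) ≤ chiSquared 2 {y | t < ENNReal.ofReal (2 * Real.log N + y)} := by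
  rcases eq_or_ne t ⊤ with rfl | ht
  · simp [expTail]
  have hset : {y | t < ENNReal.ofReal (2 * Real.log N + y)} =
      Set.Ioi (t.toReal - 2 * Real.log N) := by
    ext y
    simp only [Set.mem_ofPred_eq, Set.mem_Ioi, ENNReal.lt_ofReal_iff_toReal_lt ht]
    constructor <;> intro h <;> linarith
  rw [hset]
  rcases le_total 0 (t.toReal - 2 * Real.log N) with h | h
  · refine (min_le_right _ _).trans (le_of_eq ?_)
    rw [chiSquared_two_Ioi h, expTail, if_neg ht, ← ENNReal.ofReal_natCast,
      ← ENNReal.ofReal_mul (Nat.cast_nonneg N)]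
    congr 1
    have hN' : (0 : ℝ) < N := by positivity
    nth_rewrite 1 [← Real.exp_log hN']
    rw [← Real.exp_add]
    congr 1
    ring
  · refine (min_le_left _ _).trans ?_
    have h0 := chiSquared_two_Ioi le_rfl
    rw [neg_zero, zero_div, Real.exp_zero, ENNReal.ofReal_one] at h0
    rw [← h0]
    exact measure_mono (Set.Ioi_subset_Ioi h)

/-- The `ξ`s are independent of `f` and the noise jointly, so adjoining them to the observations
preserves independence from the residual. -/
theorem indepFun_residual_pathObs {X Ω S : Type*} [Fintype X] [Fintype Ω] [MeasurableSpace S]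
    {P : Measure S} [IsProbabilityMeasure P] {k : X × Ω → X × Ω → ℝ} {v : ℝ≥0} (hv : 0 < v)
    {f : S → X × Ω → ℝ} {ε ξ : ℕ → S → ℝ} (hm : IsModel P k v f ε ξ)
    (z : ℕ → X × Ω) (n : ℕ) (a : X × Ω) :
    IndepFun (fun s => f s a - postMean k v (fun i : Fin n => z i)
      (noisyObs f ε (fun i : Fin n => z i) s) a) (pathObs f ε ξ z n) P := by
  have hY : Measurable[sourceSup f ε ξ ({none} ∪ Set.range fun i => some (Sum.inl i))]
      (noisyObs f ε fun i : Fin n => z i) :=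
    @measurable_pi_lambda _ _ _ (_) _ _ fun i =>
      ((measurable_pi_apply (z i)).comp (measurable_sourceSup_f (by simp))).add
        (measurable_sourceSup_noise (by simp))
  have hD : Measurable[sourceSup f ε ξ ({none} ∪ Set.range fun i => some (Sum.inl i))]
      (fun s => f s a - postMean k v (fun i : Fin n => z i)
        (noisyObs f ε (fun i : Fin n => z i) s) a) := by
    refine ((measurable_pi_apply a).comp (measurable_sourceSup_f (by simp))).sub ?_
    have h1 : Measurable fun y : Fin n → ℝ => postMean k v (fun i : Fin n => z i) y a := by
      simp only [postMean_eq_sum]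
      fun_prop
    exact h1.comp hY
  have hW : Measurable[sourceSup f ε ξ (Set.range fun i => some (Sum.inr i))]
      (fun s (i : Fin n) => ξ i s) :=
    @measurable_pi_lambda _ _ _ (_) _ _ fun i => measurable_sourceSup_xi ⟨(i : ℕ), rfl⟩
  refine indepFun_prodMk_of_indepFun (hD.mono (hm.sourceSup_le _) le_rfl)
    (hY.mono (hm.sourceSup_le _) le_rfl) (hW.mono (hm.sourceSup_le _) le_rfl)
    (hm.indepFun_residual_obs _ a hv) (hm.indepFun_of_disjoint ?_ (hD.prodMk hY) hW)
  rw [Set.disjoint_left]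
  rintro i (rfl | ⟨j, rfl⟩) ⟨l, hl⟩ <;> simp at hl

/-! ### Tails of the deviations at adaptively chosen points. -/

section

variable {X Ω S : Type*} [Fintype X] [Fintype Ω] [MeasurableSpace X] [MeasurableSingletonClass X]
  [MeasurableSpace Ω] [MeasurableSingletonClass Ω] [MeasurableSpace S] {P : Measure S}
  {k : X × Ω → X × Ω → ℝ} {v : ℝ≥0}
  {f : S → X × Ω → ℝ} {ε ξ : ℕ → S → ℝ} (hm : IsModel P k v f ε ξ)
  {x : ℕ → S → X} {w : ℕ → S → Ω}
  (hx : ∀ n, Measurable[history f ε ξ x w n ⊔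
    MeasurableSpace.comap (beta X Ω ξ n) inferInstance] (x n))
  (hw : ∀ n, Measurable[history f ε ξ x w n ⊔
    MeasurableSpace.comap (beta X Ω ξ n) inferInstance] (w n))
include hm hx hw

theorem measurable_data (n : ℕ) : Measurable (data f ε ξ x w n) :=
  (measurable_data_sourceSup hx hw n).mono (hm.sourceSup_le _) le_rfl

theorem measurable_x (n : ℕ) : Measurable (x n) :=
  (hx n).mono ((history_sup_le n (history_le_sourceSup hx hw n)).trans (hm.sourceSup_le _)) le_rfl

theorem measurable_w (n : ℕ) : Measurable (w n) :=
  (hw n).mono ((history_sup_le n (history_le_sourceSup hx hw n)).trans (hm.sourceSup_le _)) le_rfl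

variable [IsProbabilityMeasure P]

theorem lintegral_min_le (n : ℕ) [Nonempty (X × Ω)] {τ : (Fin n → X × Ω × ℝ × ℝ) → ℝ≥0∞}
    (hτ : Measurable τ) :
    ∫⁻ s, min 1 (Fintype.card (X × Ω) * expTail (τ (data f ε ξ x w n s))) ∂P ≤
      P {s | τ (data f ε ξ x w n s) < ENNReal.ofReal (beta X Ω ξ n s)} := by
  have hH := measurable_data hm hx hw n
  have hind : IndepFun (data f ε ξ x w n) (ξ n) P := by
    refine hm.indepFun_of_disjoint (J := {some (Sum.inr n)}) ?_
      (measurable_data_sourceSup hx hw n) (measurable_sourceSup_xi rfl)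
    rw [Set.disjoint_left]
    rintro i hi rfl
    exact hi n le_rfl rfl
  have hB : MeasurableSet {p : (Fin n → X × Ω × ℝ × ℝ) × ℝ |
      τ p.1 < ENNReal.ofReal (2 * Real.log (Fintype.card (X × Ω)) + p.2)} :=
    measurableSet_lt (hτ.comp measurable_fst) (by fun_prop)
  have h1 : P {s | τ (data f ε ξ x w n s) < ENNReal.ofReal (beta X Ω ξ n s)} =
      (P.map fun s => (data f ε ξ x w n s, ξ n s)) {p : (Fin n → X × Ω × ℝ × ℝ) × ℝ |
        τ p.1 < ENNReal.ofReal (2 * Real.log (Fintype.card (X × Ω)) + p.2)} := by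
    rw [Measure.map_apply (hH.prodMk (hm.measurable_xi n)) hB]
    rfl
  have := isProbabilityMeasure_chiSquared_two
  rw [h1, (indepFun_iff_map_prod_eq_prod_map_map hH.aemeasurable
    (hm.measurable_xi n).aemeasurable).1 hind, (hm.xi_law n).map_eq, Measure.prod_apply hB,
    lintegral_map (measurable_measure_prodMk_left hB) hH]
  exact lintegral_mono fun s => min_one_le_chiSquared_two Fintype.card_ne_zero _

variable (hv : 0 < v)
include hv

/-- On each of the finitely many events `E z` the posterior is that of regression at the fixed
points `z`, where the residual is independent of the data. Summing over the disjoint events recovers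
the full integral. -/
theorem deviation_tail_le (n : ℕ) (a : X × Ω) {τ : (Fin n → X × Ω × ℝ × ℝ) → ℝ≥0∞}
    (hτ : Measurable τ) :
    P {s | τ (data f ε ξ x w n s) ≤ deviation k v (data f ε ξ x w n s) (f s) a} ≤
      ∫⁻ s, expTail (τ (data f ε ξ x w n s)) ∂P := by
  -- Only the first `n` points matter; `a` is a filler beyond them.
  let e : (Fin n → X × Ω) → ℕ → X × Ω := fun z i => if h : i < n then z ⟨i, h⟩ else a
  have he : ∀ z (i : Fin n), e z i = z i := fun z i => by simp [e]
  let E : (Fin n → X × Ω) → Set S := fun z => {s | ∀ i < n, (x i s, w i s) = e z i}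
  have hK : ∀ z, Measurable (pathObs f ε ξ (e z) n) := fun z =>
    (measurable_pi_lambda (noisyObs f ε fun i : Fin n => e z i) fun i =>
      ((measurable_pi_apply _).comp hm.measurable_f).add
      (hm.measurable_noise i)).prodMk (measurable_pi_lambda _ fun i => hm.measurable_xi i)
  have hEK := fun z => measurableSet_path hx hw (e z) n
  have hE : ∀ z, MeasurableSet (E z) := fun z => (hK z).comap_le _ (hEK z)
  have hdisj : Pairwise (Function.onFun Disjoint E) := fun z z' hz => by
    rw [Function.onFun, Set.disjoint_left]
    intro s hs hs'
    refine hz (funext fun i => ?_)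
    rw [← he z i, ← he z' i, ← hs i i.2, ← hs' i i.2]
  have hz : ∀ z, P ({s | τ (data f ε ξ x w n s) ≤
      deviation k v (data f ε ξ x w n s) (f s) a} ∩ E z) ≤
      ∫⁻ s in E z, expTail (τ (data f ε ξ x w n s)) ∂P := fun z => by
    obtain ⟨C, hC, hCE⟩ := hEK z
    have hD : Measurable fun s => f s a - postMean k v (fun i : Fin n => e z i)
        (noisyObs f ε (fun i : Fin n => e z i) s) a := by
      refine ((measurable_pi_apply a).comp hm.measurable_f).sub ?_
      have h1 : Measurable fun y : Fin n → ℝ => postMean k v (fun i : Fin n => e z i) y a := by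
        simp only [postMean_eq_sum]
        fun_prop
      exact h1.comp (measurable_fst.comp (hK z))
    have h := measure_normalized_tail_le (hK z) hD (indepFun_residual_pathObs hv hm (e z) n a)
      (hm.map_residual _ a hv) hC (hτ.comp (measurable_pathData (e z) n))
    rw [hCE] at h
    refine le_trans (measure_mono ?_) (h.trans_eq ?_)
    · rintro s ⟨hs, hsE⟩
      refine ⟨?_, ?_⟩
      · rw [← Set.mem_preimage, hCE]
        exact hsE
      · rw [Set.mem_ofPred_eq, data_eq_pathData hsE] at hs
        exact hs
    · refine setLIntegral_congr_fun (hE z) fun s hs => ?_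
      simp only [Function.comp_apply]
      rw [data_eq_pathData hs]
  have hcover : ∀ s, ∃ z, s ∈ E z := fun s =>
    ⟨fun i => (x i s, w i s), fun i hi => (he (fun i => (x i s, w i s)) ⟨i, hi⟩).symm⟩
  calc P {s | τ (data f ε ξ x w n s) ≤ deviation k v (data f ε ξ x w n s) (f s) a}
      ≤ P (⋃ z, {s | τ (data f ε ξ x w n s) ≤
          deviation k v (data f ε ξ x w n s) (f s) a} ∩ E z) :=
        measure_mono fun s hs => Set.mem_iUnion.2 ((hcover s).imp fun z hz => ⟨hs, hz⟩)
    _ ≤ ∑' z, P ({s | τ (data f ε ξ x w n s) ≤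
          deviation k v (data f ε ξ x w n s) (f s) a} ∩ E z) := measure_iUnion_le _
    _ ≤ ∑' z, ∫⁻ s in E z, expTail (τ (data f ε ξ x w n s)) ∂P := ENNReal.tsum_le_tsum hz
    _ = ∫⁻ s in ⋃ z, E z, expTail (τ (data f ε ξ x w n s)) ∂P :=
        (lintegral_iUnion hE hdisj _).symm
    _ ≤ ∫⁻ s, expTail (τ (data f ε ξ x w n s)) ∂P := setLIntegral_le_lintegral _ _

/-- Conditionally on the data, the largest deviation is stochastically dominated by `β`. -/
theorem deviation_dominated (n : ℕ) {τ : (Fin n → X × Ω × ℝ × ℝ) → ℝ≥0∞}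
    (hτ : Measurable τ) [Nonempty (X × Ω)] :
    P {s | τ (data f ε ξ x w n s) ≤ ⨆ a, deviation k v (data f ε ξ x w n s) (f s) a} ≤
      P {s | τ (data f ε ξ x w n s) < ENNReal.ofReal (beta X Ω ξ n s)} := by
  refine le_trans ?_ (lintegral_min_le hm hx hw n hτ)
  set N := Fintype.card (X × Ω)
  set H := data f ε ξ x w n
  have hH : Measurable H := measurable_data hm hx hw n
  have hc : Measurable fun h => (N : ℝ≥0∞) * expTail (τ h) :=
    (measurable_expTail.comp hτ).const_mul _
  -- The union bound is applied only where it is at most `1`. Elsewhere `τ' = ⊤` costs nothing, as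
  -- `expTail ⊤ = 0`, and the conditional probability is bounded by `1`. This puts the minimum
  -- inside the integral.
  let τ' : (Fin n → X × Ω × ℝ × ℝ) → ℝ≥0∞ := fun h => if N * expTail (τ h) ≤ 1 then τ h else ⊤
  have hτ' : Measurable τ' :=
    Measurable.ite (measurableSet_le hc measurable_const) hτ measurable_const
  have hB : MeasurableSet {s | 1 < N * expTail (τ (H s))} :=
    measurableSet_lt measurable_const (hc.comp hH)
  calc P {s | τ (H s) ≤ ⨆ a, deviation k v (H s) (f s) a}
      ≤ P ({s | 1 < N * expTail (τ (H s))} ∪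
          ⋃ a, {s | τ' (H s) ≤ deviation k v (H s) (f s) a}) := by
        refine measure_mono fun s hs => ?_
        by_cases h : N * expTail (τ (H s)) ≤ 1
        · right
          obtain ⟨a, ha⟩ := exists_eq_ciSup_of_finite (f := deviation k v (H s) (f s))
          refine Set.mem_iUnion.2 ⟨a, ?_⟩
          rw [Set.mem_ofPred_eq, ha]
          simpa only [τ', if_pos h, Set.mem_ofPred_eq] using hs
        · exact Or.inl (not_le.1 h)
    _ ≤ P {s | 1 < N * expTail (τ (H s))} +
          ∑ a, P {s | τ' (H s) ≤ deviation k v (H s) (f s) a} :=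
        (measure_union_le _ _).trans (add_le_add le_rfl (measure_iUnion_fintype_le _ _))
    _ ≤ P {s | 1 < N * expTail (τ (H s))} + ∑ _a : X × Ω, ∫⁻ s, expTail (τ' (H s)) ∂P := by
        gcongr with a
        exact deviation_tail_le hm hx hw hv n a hτ'
    _ = ∫⁻ s, ({s | 1 < N * expTail (τ (H s))}.indicator 1 s + N * expTail (τ' (H s))) ∂P := by
        rw [lintegral_add_left (measurable_one.indicator hB), lintegral_indicator_one hB,
          lintegral_const_mul (N : ℝ≥0∞) (f := fun s => expTail (τ' (H s)))
            (measurable_expTail.comp (hτ'.comp hH)), Finset.sum_const,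
          Finset.card_univ, nsmul_eq_mul]
    _ ≤ ∫⁻ s, min 1 (N * expTail (τ (H s))) ∂P := by
        refine lintegral_mono fun s => ?_
        by_cases h : N * expTail (τ (H s)) ≤ 1
        · have h' : s ∉ {s | 1 < N * expTail (τ (H s))} := not_lt.2 h
          simp only [Set.indicator_of_notMem h', τ', if_pos h, zero_add, min_eq_right h, le_refl]
        · have h' : s ∈ {s | 1 < N * expTail (τ (H s))} := not_le.1 h
          have h2 : expTail ⊤ = 0 := if_pos rfl
          simp only [Set.indicator_of_mem h', τ', if_neg h, h2, mul_zero, add_zero, Pi.one_apply,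
            min_eq_left (not_le.1 h).le, le_refl]

end

/-! ### The regret of a single iteration -/

/-- One factor `2` comes from the gap bound, one from the two sides of the credible interval, and a
third from `q` for the mean absolute deviation. -/
theorem RobustnessMeasure.two_mul_q (ρ : RobustnessMeasure) (a : ℝ) :
    2 * ρ.q (2 * a) = ρ.regretConst * a := by
  cases ρ <;> simp only [q, regretConst] <;> ring

theorem RobustnessMeasure.regretConst_nonneg (ρ : RobustnessMeasure) : 0 ≤ ρ.regretConst := by
  cases ρ <;> simp [regretConst]

/-- The gap between the optimal value of `ρ` and its value at `b`, for the function `g`. -/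
noncomputable def gap {X Ω : Type*} [MeasurableSpace Ω] (Pst : Measure Ω) (ρ : RobustnessMeasure)
    (g : X × Ω → ℝ) (b : X) : ℝ :=
  (⨆ a, ρ.value Pst fun w => g (a, w)) - ρ.value Pst fun w => g (b, w)

theorem gap_nonneg {X Ω : Type*} [Finite X] [MeasurableSpace Ω] (Pst : Measure Ω)
    (ρ : RobustnessMeasure) (g : X × Ω → ℝ) (b : X) : 0 ≤ gap Pst ρ g b :=
  sub_nonneg.2 (le_ciSup (f := fun a => ρ.value Pst fun w => g (a, w))
    (Set.finite_range _).bddAbove b)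

theorem gap_eq {X Ω : Type*} [Finite X] [MeasurableSpace Ω] (Pst : Measure Ω)
    (ρ : RobustnessMeasure) (g : X × Ω → ℝ) (b c : X)
    (h : ∀ a, ρ.value Pst (fun w => g (a, w)) ≤ ρ.value Pst fun w => g (c, w)) :
    gap Pst ρ g b = (ρ.value Pst fun w => g (c, w)) - ρ.value Pst fun w => g (b, w) := by
  have : Nonempty X := ⟨b⟩
  rw [gap]
  congr 1
  exact le_antisymm (ciSup_le h) (le_ciSup (f := fun a => ρ.value Pst fun w => g (a, w))
    (Set.finite_range _).bddAbove c)

theorem measurable_gap {X Ω : Type*} [Finite X] [Fintype Ω] [MeasurableSpace X]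
    [MeasurableSingletonClass X] [MeasurableSpace Ω] [MeasurableSingletonClass Ω]
    (Pst : Measure Ω) [IsProbabilityMeasure Pst] {ρ : RobustnessMeasure} (hρ : ρ.LevelValid) :
    Measurable fun p : (X × Ω → ℝ) × X => gap Pst ρ p.1 p.2 := by
  refine measurable_from_prod_countable_left fun b => ?_
  have h : ∀ a, Measurable fun g : X × Ω → ℝ => ρ.value Pst fun w => g (a, w) := fun a =>
    (RobustnessMeasure.measurable_value Pst hρ).comp (by fun_prop)
  exact (Measurable.iSup h).sub (h b)

/-- Square roots and `ENNReal.ofReal` both truncate negative numbers to `0`. If `V ≤ 0`, the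
hypothesis forces `d = 0`, since a positive number divided by `0` is `⊤`. -/
theorem abs_sub_le_of_div_le {d V b : ℝ}
    (h : ENNReal.ofReal (d ^ 2) / ENNReal.ofReal V ≤ ENNReal.ofReal b) : |d| ≤ √b * √V := by
  rw [ENNReal.div_le_iff_le_mul (Or.inr ENNReal.ofReal_ne_top) (Or.inl ENNReal.ofReal_ne_top)] at h
  have h2 : d ^ 2 ≤ max b 0 * max V 0 := by
    rw [← ENNReal.ofReal_le_ofReal_iff (by positivity), ENNReal.ofReal_mul (le_max_right _ _)]
    simpa using h
  have h3 : ∀ y : ℝ, √(max y 0) = √y := fun y => by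
    rcases le_total y 0 with hy | hy
    · simp [hy, Real.sqrt_eq_zero_of_nonpos hy]
    · simp [hy]
  rw [← Real.sqrt_sq_eq_abs, ← h3 b, ← h3 V, ← Real.sqrt_mul (le_max_right _ _)]
  exact Real.sqrt_le_sqrt h2

section

variable {X Ω S : Type*} [Fintype X] [Fintype Ω] {k : X × Ω → X × Ω → ℝ} {v : ℝ≥0}
  {f : S → X × Ω → ℝ} {ε ξ : ℕ → S → ℝ} {x : ℕ → S → X} {w : ℕ → S → Ω}

theorem mem_interval_of_deviation_le {n : ℕ} {s : S} {g : X × Ω → ℝ}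
    (h : ⨆ a, deviation k v (data f ε ξ x w n s) g a ≤ ENNReal.ofReal (beta X Ω ξ n s))
    (z : X × Ω) : lower k v f ε ξ x w n s z ≤ g z ∧ g z ≤ upper k v f ε ξ x w n s z := by
  have h1 := abs_le.1 (abs_sub_le_of_div_le ((le_iSup _ z).trans h))
  have h2 : mu k v f ε x w n s z = postMean k v (dataPts (data f ε ξ x w n s))
    (dataObs (data f ε ξ x w n s)) z := rfl
  have h3 : var k v x w n s z = postVar k v (dataPts (data f ε ξ x w n s)) z := rfl
  rw [lower, upper, h2, h3]
  constructor <;> linarith [h1.1, h1.2]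

theorem lower_le_mu (n : ℕ) (s : S) (z : X × Ω) :
    lower k v f ε ξ x w n s z ≤ mu k v f ε x w n s z ∧
      mu k v f ε x w n s z ≤ upper k v f ε ξ x w n s z := by
  have := mul_nonneg (Real.sqrt_nonneg (beta X Ω ξ n s)) (Real.sqrt_nonneg (var k v x w n s z))
  rw [lower, upper]
  constructor <;> linarith

/-- The gap of every function in the credible intervals is bounded by twice the width of the
credible interval of `ρ` at the selected point. -/
theorem gap_le_two_mul_width [MeasurableSpace Ω] {Pst : Measure Ω} {ρ : RobustnessMeasure}
    {lcb ucb : ℕ → S → X → ℝ} (hE : IsEnclosure Pst ρ k v f ε ξ lcb ucb x w) {n : ℕ} {s : S}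
    {xh xt x' : X}
    (hhat : ∀ a, ρ.value Pst (fun b => mu k v f ε x w n s (a, b)) ≤
      ρ.value Pst (fun b => mu k v f ε x w n s (xh, b)))
    (htil : ∀ a, max (ucb n s a - ⨆ a', lcb n s a') 0 ≤ max (ucb n s xt - ⨆ a', lcb n s a') 0)
    (hxt : ucb n s xt - lcb n s xt ≤ ucb n s x' - lcb n s x')
    (hxh : ucb n s xh - lcb n s xh ≤ ucb n s x' - lcb n s x') {g : X × Ω → ℝ}
    (hg : ∀ z, lower k v f ε ξ x w n s z ≤ g z ∧ g z ≤ upper k v f ε ξ x w n s z) :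
    gap Pst ρ g xh ≤ 2 * (ucb n s x' - lcb n s x') := by
  have : Nonempty X := ⟨xh⟩
  have hgE := fun a => hE n s a (fun b => g (a, b)) fun b => hg (a, b)
  have hmu := fun a => hE n s a (fun b => mu k v f ε x w n s (a, b)) fun b => lower_le_mu n s (a, b)
  -- The posterior mean itself lies in the credible intervals, so its `ρ`-values are enclosed, and
  -- `xh` maximizes them.
  have hL : ⨆ a', lcb n s a' ≤ ucb n s xh :=
    ciSup_le fun a => (hmu a).1.trans ((hhat a).trans (hmu xh).2)
  have hLt : lcb n s xt ≤ ⨆ a', lcb n s a' := le_ciSup (Set.finite_range _).bddAbove xt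
  have hw0 : 0 ≤ ucb n s x' - lcb n s x' := by
    linarith [(hmu x').1, (hmu x').2]
  -- The excess of `ucb` over `max lcb` is largest at `xt`, and there it is at most the width,
  -- because `lcb` at `xt` does not exceed `max lcb`.
  have hsup : ⨆ a, ρ.value Pst (fun b => g (a, b)) ≤
      (⨆ a', lcb n s a') + (ucb n s x' - lcb n s x') := by
    refine ciSup_le fun a => ?_
    have h1 : ucb n s a - ⨆ a', lcb n s a' ≤ ucb n s x' - lcb n s x' :=
      (le_max_left _ 0).trans ((htil a).trans (max_le (by linarith) hw0))
    linarith [(hgE a).2]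
  rw [gap]
  linarith [(hgE xh).1]

end

section

variable {X Ω S : Type*} [Fintype X] [Fintype Ω] [MeasurableSpace X] [MeasurableSingletonClass X]
  [MeasurableSpace Ω] [MeasurableSingletonClass Ω] [MeasurableSpace S] {P : Measure S}
  [IsProbabilityMeasure P] {Pst : Measure Ω} [IsProbabilityMeasure Pst] {ρ : RobustnessMeasure}
  {k : X × Ω → X × Ω → ℝ} {v : ℝ≥0} {f : S → X × Ω → ℝ} {ε ξ : ℕ → S → ℝ}
  {x : ℕ → S → X} {w : ℕ → S → Ω}

/-- Since `xh` depends on the past data and not on the current `β`, it is fixed once the data are,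
and the domination of the deviation by `β` given the data can be applied to its gap. -/
theorem lintegral_gap_le (hm : IsModel P k v f ε ξ)
    (hx : ∀ n, Measurable[history f ε ξ x w n ⊔
      MeasurableSpace.comap (beta X Ω ξ n) inferInstance] (x n))
    (hw : ∀ n, Measurable[history f ε ξ x w n ⊔
      MeasurableSpace.comap (beta X Ω ξ n) inferInstance] (w n)) (hv : 0 < v)
    (hρ : ρ.LevelValid) (n : ℕ) {xh : S → X} (hxh : Measurable[history f ε ξ x w n] xh)
    {Φ : S → ℝ} (hΦ : Measurable Φ) (hΦ0 : ∀ s, 0 ≤ Φ s)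
    (hle : ∀ᵐ s ∂P, ∀ g : X × Ω → ℝ,
      (∀ z, lower k v f ε ξ x w n s z ≤ g z ∧ g z ≤ upper k v f ε ξ x w n s z) →
        gap Pst ρ g (xh s) ≤ Φ s) :
    ∫⁻ s, ENNReal.ofReal (gap Pst ρ (f s) (xh s)) ∂P ≤ ∫⁻ s, ENNReal.ofReal (Φ s) ∂P := by
  obtain ⟨s₀⟩ := nonempty_of_isProbabilityMeasure P
  have : Nonempty X := ⟨xh s₀⟩
  have : Nonempty (X × Ω) := ⟨(xh s₀, w 0 s₀)⟩
  rw [history_eq_comap] at hxh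
  obtain ⟨φ, hφ, rfl⟩ := hxh.exists_eq_measurable_comp
  have hG : Measurable (Function.uncurry fun (h : Fin n → X × Ω × ℝ × ℝ) (g : X × Ω → ℝ) =>
      ⨆ a, deviation k v h g a) :=
    Measurable.iSup fun a => measurable_deviation k v n a
  have hr : Measurable (Function.uncurry fun (h : Fin n → X × Ω × ℝ × ℝ) (g : X × Ω → ℝ) =>
      gap Pst ρ g (φ h)) :=
    (measurable_gap Pst hρ).comp (measurable_snd.prodMk (hφ.comp measurable_fst))
  refine lintegral_le_lintegral_of_dominated P (measurable_data hm hx hw n) hm.measurable_f hG hr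
    (fun h g => gap_nonneg Pst ρ g (φ h)) hΦ hΦ0
    (fun τ hτ => deviation_dominated hm hx hw hv n hτ) ?_
  filter_upwards [hle] with s hs g hg
  exact hs g (mem_interval_of_deviation_le hg)

end

/-! ### The moments of `β` -/

section

variable {X Ω S : Type*} [Fintype X] [Fintype Ω] [MeasurableSpace S] {P : Measure S}
  {ξ : ℕ → S → ℝ} {n : ℕ}

theorem ae_nonneg_of_chiSquared_two (h : HasLaw (ξ n) (chiSquared 2) P) : ∀ᵐ s ∂P, 0 ≤ ξ n s := by
  have h1 : ∀ᵐ y ∂(P.map (ξ n)), 0 ≤ y := by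
    rw [h.map_eq, ae_iff]
    simpa using! chiSquared_two_Iio_zero
  exact ae_of_ae_map h.aemeasurable h1

theorem lintegral_xi (h : HasLaw (ξ n) (chiSquared 2) P) :
    ∫⁻ s, ENNReal.ofReal (ξ n s) ∂P = 2 := by
  rw [← lintegral_chiSquared_two, ← h.map_eq, lintegral_map' (by fun_prop) h.aemeasurable]

theorem integrable_xi (h : HasLaw (ξ n) (chiSquared 2) P) : Integrable (ξ n) P := by
  refine ⟨h.aemeasurable.aestronglyMeasurable, ?_⟩
  rw [hasFiniteIntegral_iff_ofReal (ae_nonneg_of_chiSquared_two h), lintegral_xi h]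
  exact ENNReal.ofNat_lt_top

theorem integral_xi (h : HasLaw (ξ n) (chiSquared 2) P) : ∫ s, ξ n s ∂P = 2 := by
  rw [integral_eq_lintegral_of_nonneg_ae (ae_nonneg_of_chiSquared_two h)
    h.aemeasurable.aestronglyMeasurable, lintegral_xi h]
  simp

theorem ae_beta_nonneg (h : HasLaw (ξ n) (chiSquared 2) P) : ∀ᵐ s ∂P, 0 ≤ beta X Ω ξ n s := by
  filter_upwards [ae_nonneg_of_chiSquared_two h] with s hs
  have := Real.log_natCast_nonneg (Fintype.card (X × Ω))
  rw [beta]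
  linarith

theorem integrable_beta [IsFiniteMeasure P] (h : HasLaw (ξ n) (chiSquared 2) P) :
    Integrable (beta X Ω ξ n) P :=
  (integrable_const _).add (integrable_xi h)

theorem integral_beta [IsProbabilityMeasure P] (h : HasLaw (ξ n) (chiSquared 2) P) :
    ∫ s, beta X Ω ξ n s ∂P = 2 * Real.log (Fintype.card (X × Ω)) + 2 := by
  simp only [beta]
  rw [integral_add (integrable_const _) (integrable_xi h), integral_xi h]
  simp

end

/-! ### The cumulative regret -/

theorem integrable_sqrt {S : Type*} [MeasurableSpace S] {P : Measure S} [IsFiniteMeasure P]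
    {B : S → ℝ} (hB : Integrable B P) : Integrable (fun s => √(B s)) P := by
  refine ((integrable_const (1 : ℝ)).add hB.abs).mono'
    (Real.continuous_sqrt.comp_aestronglyMeasurable hB.aestronglyMeasurable)
    (ae_of_all _ fun s => ?_)
  rw [Real.norm_of_nonneg (Real.sqrt_nonneg _)]
  refine Real.sqrt_le_iff.2 ⟨add_nonneg zero_le_one (abs_nonneg (B s)), ?_⟩
  have := abs_nonneg (B s)
  simp only [Pi.add_apply]
  nlinarith [le_abs_self (B s)]

theorem integral_sqrt_le {S : Type*} [MeasurableSpace S] {P : Measure S} [IsProbabilityMeasure P]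
    {B : S → ℝ} (hB : Integrable B P) (h0 : ∀ᵐ s ∂P, 0 ≤ B s) :
    ∫ s, √(B s) ∂P ≤ √(∫ s, B s ∂P) :=
  Real.strictConcaveOn_sqrt.concaveOn.le_map_integral Real.continuous_sqrt.continuousOn
    isClosed_Ici h0 hB (integrable_sqrt hB)

section

variable {X Ω S : Type*} [Fintype X] [Fintype Ω] [MeasurableSpace X] [MeasurableSingletonClass X]
  [MeasurableSpace Ω] [MeasurableSingletonClass Ω] [MeasurableSpace S] {P : Measure S}
  {k : X × Ω → X × Ω → ℝ} {v : ℝ≥0} {f : S → X × Ω → ℝ} {ε ξ : ℕ → S → ℝ}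
  {x : ℕ → S → X} {w : ℕ → S → Ω}

theorem measurable_var (hx : ∀ n, Measurable (x n)) (hw : ∀ n, Measurable (w n)) (n : ℕ) :
    Measurable fun s => var k v x w n s (x n s, w n s) := by
  have h1 : Measurable fun p : (Fin n → X × Ω) × (X × Ω) => postVar k v p.1 p.2 :=
    measurable_of_countable _
  have h2 : Measurable fun s => ((fun i : Fin n => (x i s, w i s)), (x n s, w n s)) := by
    fun_prop
  exact h1.comp h2

variable [IsProbabilityMeasure P]

theorem integrable_width (hm : IsModel P k v f ε ξ) (hv : 0 < v)
    (hx : ∀ n, Measurable (x n)) (hw : ∀ n, Measurable (w n)) (n : ℕ) :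
    Integrable (fun s => √(beta X Ω ξ n s) * √(var k v x w n s (x n s, w n s))) P := by
  refine (integrable_sqrt (integrable_beta (X := X) (Ω := Ω) (hm.xi_law n))).mono'
    ((((hm.measurable_xi n).const_add _).sqrt).mul
      (measurable_var hx hw n).sqrt).aestronglyMeasurable (ae_of_all _ fun s => ?_)
  rw [Real.norm_of_nonneg (by positivity)]
  refine mul_le_of_le_one_right (Real.sqrt_nonneg _) (Real.sqrt_le_one.2 ?_)
  exact (postVar_le hm.kernel_posSemidef (NNReal.coe_pos.2 hv) _ _).trans (hm.kernel_le_one _)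

/-- Cauchy–Schwarz on each path separates the `β`s from the variances. The sum of the variances has
a deterministic bound, so no independence between `β` and the selected points is needed, and Jensen
handles the remaining root. -/
theorem integral_sum_width_le (hm : IsModel P k v f ε ξ) (hv : 0 < v)
    (hx : ∀ n, Measurable (x n)) (hw : ∀ n, Measurable (w n)) (t : ℕ) :
    ∫ s, ∑ n ∈ Finset.range t, √(beta X Ω ξ n s) * √(var k v x w n s (x n s, w n s)) ∂P ≤
      √(t * (2 * (2 * Real.log (Fintype.card (X × Ω)) + 2) / Real.log (1 + (v : ℝ)⁻¹)) *
        maxInfoGain k v t) := by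
  have hv' := NNReal.coe_pos.2 hv
  set M := 2 * maxInfoGain k v t / Real.log (1 + (v : ℝ)⁻¹) with hM
  have hβ : ∀ᵐ s ∂P, ∀ n, 0 ≤ beta X Ω ξ n s := ae_all_iff.2 fun n => ae_beta_nonneg (hm.xi_law n)
  have hB : Integrable (fun s => ∑ n ∈ Finset.range t, beta X Ω ξ n s) P :=
    integrable_finsetSum _ fun n _ => integrable_beta (hm.xi_law n)
  have hEB : ∫ s, ∑ n ∈ Finset.range t, beta X Ω ξ n s ∂P =
      t * (2 * Real.log (Fintype.card (X × Ω)) + 2) := by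
    rw [integral_finsetSum _ fun n _ => integrable_beta (hm.xi_law n)]
    simp only [integral_beta (hm.xi_law _), Finset.sum_const, Finset.card_range, nsmul_eq_mul]
  have hEB0 : 0 ≤ (t : ℝ) * (2 * Real.log (Fintype.card (X × Ω)) + 2) := by
    have := Real.log_natCast_nonneg (Fintype.card (X × Ω))
    positivity
  calc ∫ s, ∑ n ∈ Finset.range t, √(beta X Ω ξ n s) * √(var k v x w n s (x n s, w n s)) ∂P
      ≤ ∫ s, √(∑ n ∈ Finset.range t, beta X Ω ξ n s) * √M ∂P := by
        refine integral_mono_ae (integrable_finsetSum _ fun n _ => integrable_width hm hv hx hw n)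
          ((integrable_sqrt hB).mul_const _) ?_
        filter_upwards [hβ] with s hs
        refine (Real.sum_sqrt_mul_sqrt_le _ hs fun n =>
          postVar_nonneg hm.kernel_posSemidef hv' _ _).trans ?_
        refine mul_le_mul_of_nonneg_left (Real.sqrt_le_sqrt ?_) (Real.sqrt_nonneg _)
        exact sum_postVar_le hm.kernel_posSemidef hm.kernel_le_one hv' (fun n => (x n s, w n s)) t
    _ = (∫ s, √(∑ n ∈ Finset.range t, beta X Ω ξ n s) ∂P) * √M := integral_mul_const _ _
    _ ≤ √(∫ s, ∑ n ∈ Finset.range t, beta X Ω ξ n s ∂P) * √M := by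
        refine mul_le_mul_of_nonneg_right (integral_sqrt_le hB ?_) (Real.sqrt_nonneg _)
        filter_upwards [hβ] with s hs
        exact Finset.sum_nonneg fun n _ => hs n
    _ = √(t * (2 * (2 * Real.log (Fintype.card (X × Ω)) + 2) / Real.log (1 + (v : ℝ)⁻¹)) *
        maxInfoGain k v t) := by
        rw [hEB, ← Real.sqrt_mul hEB0, hM]
        congr 1
        ring

variable {Pst : Measure Ω} [IsProbabilityMeasure Pst] {ρ : RobustnessMeasure}
  {lcb ucb : ℕ → S → X → ℝ} {xhat xtil : ℕ → S → X}

/-- The run may use another measure `ρ'`, provided `xhat` almost surely maximizes `ρ` of the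
posterior mean. This covers the conditional tail mean, which is analysed through the quantile
average. -/
theorem integral_sum_gap_le (hm : IsModel P k v f ε ξ) (hv : 0 < v) (hρ : ρ.LevelValid)
    {ρ' : RobustnessMeasure} (hrun : IsRun Pst ρ' k v f ε ξ lcb ucb xhat xtil x w)
    (hE : IsEnclosure Pst ρ k v f ε ξ lcb ucb x w) (hW : HasWidthBound ρ k v ξ lcb ucb x w)
    (hhat : ∀ᵐ s ∂P, ∀ n a, ρ.value Pst (fun b => mu k v f ε x w n s (a, b)) ≤
      ρ.value Pst (fun b => mu k v f ε x w n s (xhat n s, b))) (t : ℕ) :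
    Integrable (fun s => ∑ n ∈ Finset.range t, gap Pst ρ (f s) (xhat n s)) P ∧
      ∫ s, ∑ n ∈ Finset.range t, gap Pst ρ (f s) (xhat n s) ∂P ≤
        ρ.regretConst *
          √(t * (2 * (2 * Real.log (Fintype.card (X × Ω)) + 2) / Real.log (1 + (v : ℝ)⁻¹)) *
            maxInfoGain k v t) := by
  have : Nonempty Ω := nonempty_of_isProbabilityMeasure Pst
  have hx := measurable_x hm hrun.x_measurable hrun.w_measurable
  have hw := measurable_w hm hrun.x_measurable hrun.w_measurable
  let Φ : ℕ → S → ℝ := fun n s =>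
    ρ.regretConst * (√(beta X Ω ξ n s) * √(var k v x w n s (x n s, w n s)))
  have hΦi : ∀ n, Integrable (Φ n) P := fun n => (integrable_width hm hv hx hw n).const_mul _
  have hΦ0 : ∀ n s, 0 ≤ Φ n s := fun n s =>
    mul_nonneg ρ.regretConst_nonneg (by positivity)
  have hΦm : ∀ n, Measurable (Φ n) := fun n =>
    ((((hm.measurable_xi n).const_add _).sqrt).mul (measurable_var hx hw n).sqrt).const_mul _
  have hle : ∀ n, ∀ᵐ s ∂P, ∀ g : X × Ω → ℝ,
      (∀ z, lower k v f ε ξ x w n s z ≤ g z ∧ g z ≤ upper k v f ε ξ x w n s z) →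
        gap Pst ρ g (xhat n s) ≤ Φ n s := fun n => by
    filter_upwards [hhat] with s hs g hg
    refine (gap_le_two_mul_width hE (hs n) (hrun.xtil_max n s) (hrun.x_max_xtil n s)
      (hrun.x_max_xhat n s) hg).trans ?_
    have hsup : ⨆ b, √(var k v x w n s (x n s, b)) = √(var k v x w n s (x n s, w n s)) :=
      le_antisymm (ciSup_le fun b => Real.sqrt_le_sqrt (hrun.w_max n s b))
        (le_ciSup (f := fun b => √(var k v x w n s (x n s, b))) (Set.finite_range _).bddAbove _)
    have h := hW n s
    rw [hsup, mul_assoc] at h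
    exact (mul_le_mul_of_nonneg_left h zero_le_two).trans_eq (ρ.two_mul_q _)
  have hlint := fun n => lintegral_gap_le hm hrun.x_measurable hrun.w_measurable hv hρ n
    (hrun.xhat_measurable n) (hΦm n) (hΦ0 n) (hle n)
  have hgm : ∀ n, Measurable fun s => gap Pst ρ (f s) (xhat n s) := fun n =>
    (measurable_gap Pst hρ).comp (hm.measurable_f.prodMk ((hrun.xhat_measurable n).mono
      ((history_le_sourceSup hrun.x_measurable hrun.w_measurable n).trans (hm.sourceSup_le _))
      le_rfl))
  have hΦt : ∀ n, ∫⁻ s, ENNReal.ofReal (Φ n s) ∂P < ⊤ := fun n =>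
    (hasFiniteIntegral_iff_ofReal (ae_of_all _ (hΦ0 n))).1 (hΦi n).2
  have hgi : ∀ n, Integrable (fun s => gap Pst ρ (f s) (xhat n s)) P := fun n =>
    ⟨(hgm n).aestronglyMeasurable, (hasFiniteIntegral_iff_ofReal
      (ae_of_all _ fun s => gap_nonneg _ _ _ _)).2 ((hlint n).trans_lt (hΦt n))⟩
  have hgle : ∀ n, ∫ s, gap Pst ρ (f s) (xhat n s) ∂P ≤ ∫ s, Φ n s ∂P := fun n => by
    rw [integral_eq_lintegral_of_nonneg_ae (ae_of_all _ fun s => gap_nonneg _ _ _ _)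
      (hgm n).aestronglyMeasurable, integral_eq_lintegral_of_nonneg_ae (ae_of_all _ (hΦ0 n))
      (hΦm n).aestronglyMeasurable]
    exact ENNReal.toReal_mono (hΦt n).ne (hlint n)
  refine ⟨integrable_finsetSum _ fun n _ => hgi n, ?_⟩
  calc ∫ s, ∑ n ∈ Finset.range t, gap Pst ρ (f s) (xhat n s) ∂P
      = ∑ n ∈ Finset.range t, ∫ s, gap Pst ρ (f s) (xhat n s) ∂P :=
        integral_finsetSum _ fun n _ => hgi n
    _ ≤ ∑ n ∈ Finset.range t, ∫ s, Φ n s ∂P := Finset.sum_le_sum fun n _ => hgle n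
    _ = ρ.regretConst * ∫ s, ∑ n ∈ Finset.range t,
          √(beta X Ω ξ n s) * √(var k v x w n s (x n s, w n s)) ∂P := by
        rw [integral_finsetSum _ fun n _ => integrable_width hm hv hx hw n, Finset.mul_sum]
        exact Finset.sum_congr rfl fun n _ => integral_const_mul _ _
    _ ≤ _ := mul_le_mul_of_nonneg_left (integral_sum_width_le hm hv hx hw t) ρ.regretConst_nonneg

end

/-! ### The closed-form bounds -/

section

variable {X Ω S : Type*} [Fintype X] [Fintype Ω] [MeasurableSpace Ω] [MeasurableSingletonClass Ω]
  {Pst : Measure Ω} [IsProbabilityMeasure Pst] {ρ : RobustnessMeasure} (hρ : ρ.LevelValid)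
  {k : X × Ω → X × Ω → ℝ} {v : ℝ≥0} {f : S → X × Ω → ℝ} {ε ξ : ℕ → S → ℝ}
  {x : ℕ → S → X} {w : ℕ → S → Ω} {lcb ucb : ℕ → S → X → ℝ}
include hρ

theorem IsClosedForm.isEnclosure (h : IsClosedForm Pst ρ k v f ε ξ lcb ucb x w)
    (hc : ∀ α, ρ ≠ RobustnessMeasure.condValueAtRisk α) :
    IsEnclosure Pst ρ k v f ε ξ lcb ucb x w := fun n s a g hg => by
  rw [(h n s a).1, (h n s a).2]
  exact RobustnessMeasure.closed_enclosure Pst hρ hc (fun b => (hg b).1) fun b => (hg b).2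

theorem IsClosedForm.hasWidthBound (h : IsClosedForm Pst ρ k v f ε ξ lcb ucb x w) :
    HasWidthBound ρ k v ξ lcb ucb x w := fun n s => by
  rw [(h n s _).1, (h n s _).2]
  refine RobustnessMeasure.closed_width Pst hρ
    (fun b => (lower_le_mu n s _).1.trans (lower_le_mu n s _).2) fun b => ?_
  have h1 : √(var k v x w n s (x n s, b)) ≤ ⨆ b, √(var k v x w n s (x n s, b)) :=
    le_ciSup (f := fun b => √(var k v x w n s (x n s, b))) (Set.finite_range _).bddAbove b
  have h2 := mul_le_mul_of_nonneg_left h1 (Real.sqrt_nonneg (beta X Ω ξ n s))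
  rw [upper, lower]
  linarith

end

end RRGPUCB

/-! ### The regret bound. -/

theorem mainTheorem2
    {X Ω S : Type*} [Fintype X] [Fintype Ω]
    [MeasurableSpace X] [MeasurableSingletonClass X]
    [MeasurableSpace Ω] [MeasurableSingletonClass Ω]
    [MeasurableSpace S] (P : Measure S) [IsProbabilityMeasure P]
    (Pst : Measure Ω) [IsProbabilityMeasure Pst]
    (ρ : RRGPUCB.RobustnessMeasure) (hρ : ρ.LevelValid)
    (k : X × Ω → X × Ω → ℝ) (v : ℝ≥0) (hv : 0 < v)
    (f : S → X × Ω → ℝ) (ε ξ : ℕ → S → ℝ)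
    (hmodel : RRGPUCB.IsModel P k v f ε ξ)
    (lcb ucb : ℕ → S → X → ℝ) (xhat xtil x : ℕ → S → X) (w : ℕ → S → Ω)
    (hrun : RRGPUCB.IsRun Pst ρ k v f ε ξ lcb ucb xhat xtil x w)
    (hbounds :
      (RRGPUCB.IsEnclosure Pst ρ k v f ε ξ lcb ucb x w ∧
        RRGPUCB.HasWidthBound ρ k v ξ lcb ucb x w) ∨
      (RRGPUCB.IsClosedForm Pst ρ k v f ε ξ lcb ucb x w ∧
        RRGPUCB.TailFormsAgree P Pst ρ k v f ε x w))
    (xstar : S → X)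
    (hxstar : ∀ s a, ρ.value Pst (fun b => f s (a, b)) ≤
      ρ.value Pst (fun b => f s (xstar s, b)))
    (t : ℕ) (ht : 1 ≤ t) :
    Integrable (RRGPUCB.cumRegret Pst ρ f xstar xhat t) P ∧
      ∫ s, RRGPUCB.cumRegret Pst ρ f xstar xhat t s ∂P ≤
        ρ.regretConst *
          √(t * (2 * (2 * Real.log (Fintype.card (X × Ω)) + 2) / Real.log (1 + (v : ℝ)⁻¹)) *
            RRGPUCB.maxInfoGain k v t) := by
  have hR : RRGPUCB.cumRegret Pst ρ f xstar xhat t = fun s =>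
      ∑ n ∈ Finset.range t, RRGPUCB.gap Pst ρ (f s) (xhat n s) := funext fun s =>
    Finset.sum_congr rfl fun n _ =>
      (RRGPUCB.gap_eq Pst ρ (f s) (xhat n s) (xstar s) (hxstar s)).symm
  have hhat := ae_of_all P fun s n => hrun.xhat_max n s
  rw [hR]
  rcases hbounds with ⟨hE, hW⟩ | ⟨hC, hT⟩
  · exact RRGPUCB.integral_sum_gap_le hmodel hv hρ hrun hE hW hhat t
  by_cases hc : ∀ α, ρ ≠ RRGPUCB.RobustnessMeasure.condValueAtRisk α
  · exact RRGPUCB.integral_sum_gap_le hmodel hv hρ hrun (hC.isEnclosure hρ hc)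
      (hC.hasWidthBound hρ) hhat t
  push Not at hc
  obtain ⟨α, rfl⟩ := hc
  have hT' := hT α rfl
  -- Both forms of the conditional value-at-risk share the same closed-form bounds. The quantile
  -- average is monotone, so the enclosure holds for it; agreement at the posterior means transfers
  -- the maximality of `xhat`, and agreement at `f` transfers the regret.
  have hC' : RRGPUCB.IsClosedForm Pst (.avgValueAtRisk α) k v f ε ξ lcb ucb x w := hC
  have hρ' : RRGPUCB.RobustnessMeasure.LevelValid (.avgValueAtRisk α) := hρ
  have hhat' : ∀ᵐ s ∂P, ∀ n a,
      RRGPUCB.quantileTailMean Pst α (fun b => RRGPUCB.mu k v f ε x w n s (a, b)) ≤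
        RRGPUCB.quantileTailMean Pst α (fun b => RRGPUCB.mu k v f ε x w n s (xhat n s, b)) := by
    filter_upwards [hT'] with s hs n a
    rw [← (hs a).2 n, ← (hs (xhat n s)).2 n]
    exact hrun.xhat_max n s a
  have key := RRGPUCB.integral_sum_gap_le hmodel hv hρ' hrun (hC'.isEnclosure hρ' (by simp))
    (hC'.hasWidthBound hρ') hhat' t
  have hae : (fun s => ∑ n ∈ Finset.range t,
      RRGPUCB.gap Pst (.condValueAtRisk α) (f s) (xhat n s)) =ᵐ[P] fun s =>
      ∑ n ∈ Finset.range t, RRGPUCB.gap Pst (.avgValueAtRisk α) (f s) (xhat n s) := by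
    filter_upwards [hT'] with s hs
    refine Finset.sum_congr rfl fun n _ => ?_
    simp only [RRGPUCB.gap, RRGPUCB.RobustnessMeasure.value, (hs _).1]
  rw [integrable_congr hae, integral_congr_ae hae]
  exact key
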